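/- Let $\mathcal L\subset\mathbb R^2$ be any lattice and $\mathcal L'=\{\xi\in\mathbb R^2:\ \xi\cdot x\in\mathbb Z\ \text{for all } x\in\mathcal L\}$ its dual lattice, so that the Laplacian on the flat torus $\mathbb R^2/\mathcal L$ has the eigenfunctions $e^{2\pi i x\cdot\xi}$, $\xi\in\mathcal L'$, with eigenvalues $(2\pi)^2\,\xi\cdot\xi$. There are constants $a_1,a_2>0$, an orthonormal basis $v_1,v_2$ of $\mathbb R^2$ and a $\mathbb Z$-basis $b_1,b_2$ of $\mathcal L'$ such that $\xi=n_1b_1+n_2b_2$ satisfies $\xi\cdot\xi=\left(\frac{n\cdot v_1}{a_1}\right)^2+\left(\frac{n\cdot v_2}{a_2}\right)^2$ for all $n=(n_1,n_2)\in\mathbb Z^2$. Hence the eigenvalue counting function $\#\{\xi\in\mathcal L':(2\pi)^2\,\xi\cdot\xi\le t\}$ equals $N(t)=\#(\mathbb Z^2\cap E_t)$, where $$E_t=\Big\{x\in\mathbb R^2:\ (2\pi)^2\Big(\Big(\frac{x\cdot v_1}{a_1}\Big)^2+\Big(\frac{x\cdot v_2}{a_2}\Big)^2\Big)\le t\Big\}.$$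 Now let $a_1,a_2>0$ and let $v_1,v_2$ be any orthonormal basis of $\mathbb R^2$. With $E_t$ and $N(t)$ as above put $$D(t)=N(t)-\frac{a_1a_2t}{4\pi},\qquad A(R)=\frac1R\int_0^R D(t)\,dt,\qquad Q(n)=(a_1\,n\cdot v_1)^2+(a_2\,n\cdot v_2)^2,$$ $$g(x)=-\frac{\sqrt2}{\pi^{3/2}}\,a_1a_2\sum_{n\in\mathbb Z^2,\ n\ne0}Q(n)^{-5/4}\cos\!\Big(Q(n)^{1/2}x-\frac{\pi}{4}\Big).$$ The series converges absolutely for every real $x$, $g$ is a uniformly almost periodic function (a uniform limit on $\mathbb R$ of trigonometric polynomials $\sum_k c_k e^{i\omega_k x}$ with real frequencies $\omega_k$) with mean value zero, $\lim_{T\to\infty}\frac1T\int_0^T g(x)\,dx=0$, and $$A(R)=g(R^{1/2})R^{-1/4}+O(R^{-3/4})\quad\text{as }R\to\infty.$$ More generally, there is a sequence of uniformly almost periodic functions $g_1,g_2,\dots$ with $g_1=g$ such that for every integer $n\ge1$ $$A(R)=\sum_{j=1}^n g_j(R^{1/2})\,R^{\frac14-\frac j2}+O\big(R^{-\frac14-\frac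 n2}\big)\quad\text{as }R\to\infty.$$ The functions $g_j$ and the implied constants may depend on $a_1,a_2,v_1,v_2$, and the implied constant in the last formula also on $n$. -/

import Mathlib

open scoped Topology BigOperators

noncomputable section

namespace FlatTorus

/-- The Euclidean plane `ℝ²`. -/
abbrev Plane : Type := EuclideanSpace ℝ (Fin 2)

/-- The point of `ℤ²` with coordinates `n 0, n 1`, seen as a vector of the Euclidean plane. -/
def intVec (n : Fin 2 → ℤ) : Plane := WithLp.toLp 2 (fun i => (n i : ℝ))

/-- The quadratic form `((x · v₁) / a₁)² + ((x · v₂) / a₂)²`. -/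
def invForm (a : Fin 2 → ℝ) (v : OrthonormalBasis (Fin 2) ℝ Plane) (x : Plane) : ℝ :=
  (inner ℝ x (v 0) / a 0) ^ 2 + (inner ℝ x (v 1) / a 1) ^ 2

/-- The quadratic form `(a₁ (x · v₁))² + (a₂ (x · v₂))²`. -/
def Q (a : Fin 2 → ℝ) (v : OrthonormalBasis (Fin 2) ℝ Plane) (x : Plane) : ℝ :=
  (a 0 * inner ℝ x (v 0)) ^ 2 + (a 1 * inner ℝ x (v 1)) ^ 2

/-- The ellipse `E_t`. -/
def ellipse (a : Fin 2 → ℝ) (v : OrthonormalBasis (Fin 2) ℝ Plane) (t : ℝ) : Set Plane :=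
  {x | (2 * Real.pi) ^ 2 * invForm a v x ≤ t}

/-- `N(t)`, the number of points of `ℤ²` in the ellipse `E_t`. -/
def count (a : Fin 2 → ℝ) (v : OrthonormalBasis (Fin 2) ℝ Plane) (t : ℝ) : ℕ :=
  Set.ncard {n : Fin 2 → ℤ | intVec n ∈ ellipse a v t}

/-- `D(t) = N(t) - a₁ a₂ t / (4π)`, the number of lattice points minus the area of `E_t`. -/
def discrepancy (a : Fin 2 → ℝ) (v : OrthonormalBasis (Fin 2) ℝ Plane) (t : ℝ) : ℝ :=
  (count a v t : ℝ) - a 0 * a 1 * t / (4 * Real.pi)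

/-- `A(R) = (1/R) ∫₀ᴿ D(t) dt`. -/
def averagedError (a : Fin 2 → ℝ) (v : OrthonormalBasis (Fin 2) ℝ Plane) (R : ℝ) : ℝ :=
  (1 / R) * ∫ t in (0 : ℝ)..R, discrepancy a v t

/-- The term with index `n` of the series that defines `leading`. -/
def leadingTerm (a : Fin 2 → ℝ) (v : OrthonormalBasis (Fin 2) ℝ Plane) (x : ℝ)
    (n : Fin 2 → ℤ) : ℝ :=
  (Q a v (intVec n)) ^ (-(5 / 4) : ℝ) *
    Real.cos ((Q a v (intVec n)) ^ (1 / 2 : ℝ) * x - Real.pi / 4)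

/-- The leading coefficient `g(x)`: a sum over the nonzero points of `ℤ²`. -/
def leading (a : Fin 2 → ℝ) (v : OrthonormalBasis (Fin 2) ℝ Plane) (x : ℝ) : ℝ :=
  -(Real.sqrt 2 / Real.pi ^ (3 / 2 : ℝ)) * (a 0 * a 1) *
    ∑' n : {n : Fin 2 → ℤ // n ≠ 0}, leadingTerm a v x n

/-- Uniformly almost periodic functions: uniform limits on `ℝ` of trigonometric polynomials
`∑ c_ω exp (i ω x)` with arbitrary real frequencies `ω`. -/
def UniformlyAlmostPeriodic (f : ℝ → ℝ) : Prop :=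
  ∀ ε : ℝ, 0 < ε → ∃ (s : Finset ℝ) (c : ℝ → ℂ), ∀ x : ℝ,
    ‖(f x : ℂ) - ∑ ω ∈ s, c ω * Complex.exp (Complex.I * (ω : ℂ) * (x : ℂ))‖ ≤ ε

/-- The function `f` has mean value zero: `(1/T) ∫₀ᵀ f → 0` as `T → ∞`. -/
def MeanValueZero (f : ℝ → ℝ) : Prop :=
  Filter.Tendsto (fun T : ℝ => (1 / T) * ∫ x in (0 : ℝ)..T, f x) Filter.atTop (𝓝 0)

/-- The dual lattice: all `ξ` with `ξ · x ∈ ℤ` for every `x` in the lattice. -/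
def dualLattice (L : Submodule ℤ Plane) : Submodule ℤ Plane where
  carrier := {ξ | ∀ x ∈ L, ∃ k : ℤ, inner ℝ ξ x = (k : ℝ)}
  add_mem' := by
    intro ξ η hξ hη x hx
    obtain ⟨k, hk⟩ := hξ x hx
    obtain ⟨l, hl⟩ := hη x hx
    exact ⟨k + l, by rw [inner_add_left, hk, hl]; push_cast; rfl⟩
  zero_mem' := by
    intro x _
    exact ⟨0, by simp⟩
  smul_mem' := by
    intro m ξ hξ x hx
    obtain ⟨k, hk⟩ := hξ x hx
    refine ⟨m * k, ?_⟩
    rw [← Int.cast_smul_eq_zsmul ℝ m ξ, real_inner_smul_left, hk]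
    push_cast
    rfl

/-- The eigenvalue counting function of the flat torus `ℝ² / L`: the eigenfunctions
`exp (2π i x · ξ)`, with `ξ` in the dual lattice, have the eigenvalues `(2π)² ξ · ξ`. -/
def torusCount (L : Submodule ℤ Plane) (t : ℝ) : ℕ :=
  Set.ncard {ξ : Plane | ξ ∈ dualLattice L ∧ (2 * Real.pi) ^ 2 * inner ℝ ξ ξ ≤ t}

end FlatTorus

end

/-!
The integral of the discrepancy over `[0, R]` is `∑ (R - λ)₊` minus an area term, the sum being
over the values `λ` of the form `(2π)² invForm` on `ℤ²` (`integral_count`). The summand is a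
continuous function of compact support, so Poisson summation (`hasSum_integral_wave_mul`, proved
by periodization from the theory of Fourier series on the torus) applies as soon as its Fourier
transform is summable over `ℤ²`. After a linear change of coordinates the Fourier transform is
that of `(R - |y|²)₊` on the plane, and integrating out the coordinate orthogonal to the frequency
leaves a multiple of `R² H(√(Q(n) R))` with `H(z) = ∫_{-1}^1 (1 - s²)^{3/2} cos (z s) ds`, that
is, of the Bessel function `J₂` (`integral_wave_mul_max_invForm`). The frequency `0` gives exactly
the area term. So the averaged error `A(R)` is a constant times `R ∑_{n ≠ 0} H(√(Q(n) R))`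
(`averagedError_eq`).

The function `H` has a complete asymptotic expansion in `z^{-5/2-k} Im (α_k e^{iz})`
(`exists_expansion_besselInt`): the segment `[-1, 1]` is shifted to the two vertical half lines at
`±1`, where the integrand decays exponentially, and Watson's lemma is applied there. The error
bounds hold for all `z > 0`, and `∑_{n ≠ 0} Q(n)^{-s}` converges for `s > 1`; the smallest
exponent that occurs is `5/4`. Hence the expansion can be summed over `n` term by term
(`exists_expansion_averagedError`). Its coefficients are absolutely convergent trigonometric
series in `√R` with the nonzero frequencies `√Q(n)`, so they are uniformly almost periodic and
have mean zero (`uniformlyAlmostPeriodic_tsum`, `meanValueZero_tsum`).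

For the torus itself, the Gram matrix of a basis of the dual lattice is positive definite, and its
eigenvalues and eigenvectors give the axes of the ellipses (`exists_diagonalization`).
-/

open scoped Topology BigOperators

noncomputable section

namespace FlatTorus

/-! ### Poisson summation on `ℤ^ι` -/

section Poisson

open MeasureTheory Set

variable {ι : Type*}

/-- The half-open unit cube with lower corner at the integer point `m`. -/
def unitCube (m : ι → ℤ) : Set (ι → ℝ) := {x | ∀ i, x i ∈ Ioc (m i : ℝ) (m i + 1)}

lemma mem_unitCube_iff (m : ι → ℤ) (x : ι → ℝ) : x ∈ unitCube m ↔ ∀ i, ⌈x i⌉ = m i + 1 := by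
  refine forall_congr' fun i => ?_
  rw [Int.ceil_eq_iff, mem_Ioc]
  push_cast
  constructor <;> rintro ⟨h1, h2⟩ <;> constructor <;> linarith

lemma pairwise_disjoint_unitCube :
    Pairwise (Function.onFun Disjoint (unitCube : (ι → ℤ) → Set (ι → ℝ))) := by
  intro m n hmn
  refine disjoint_left.2 fun x hx hy => hmn (funext fun i => ?_)
  have h1 := (mem_unitCube_iff m x).1 hx i
  have h2 := (mem_unitCube_iff n x).1 hy i
  omega

lemma iUnion_unitCube : ⋃ m : ι → ℤ, unitCube m = (univ : Set (ι → ℝ)) := by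
  refine eq_univ_of_forall fun x => mem_iUnion.2 ⟨fun i => ⌈x i⌉ - 1, ?_⟩
  rw [mem_unitCube_iff]
  intro i
  ring

/-- The periodization of `f`, as a function on `ℝ^ι`. -/
def periodization (f : (ι → ℝ) → ℂ) (x : ι → ℝ) : ℂ := ∑' m : ι → ℤ, f (x + fun i => (m i : ℝ))

lemma periodization_add_int (f : (ι → ℝ) → ℂ) (x : ι → ℝ) (k : ι → ℤ) :
    periodization f (x + fun i => (k i : ℝ)) = periodization f x := by
  unfold periodization
  rw [← (Equiv.addLeft k).tsum_eq (fun m : ι → ℤ => f (x + fun i => (m i : ℝ)))]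
  refine tsum_congr fun m => congrArg f ?_
  ext i
  simp [add_assoc]

/-- Values of the periodization do not depend on the representatives of classes mod `1`. -/
lemma periodization_out (f : (ι → ℝ) → ℂ) (x : ι → ℝ) :
    (periodization f fun i => (QuotientAddGroup.mk (x i) : UnitAddCircle).out) =
      periodization f x := by
  have h : ∀ i, ∃ k : ℤ, (QuotientAddGroup.mk (x i) : UnitAddCircle).out = x i + k := by
    intro i
    obtain ⟨⟨g, hg⟩, h⟩ := QuotientAddGroup.mk_out_eq_add (AddSubgroup.zmultiples (1 : ℝ)) (x i)
    obtain ⟨k, rfl⟩ := AddSubgroup.mem_zmultiples_iff.1 hg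
    exact ⟨k, by simpa using h⟩
  choose k hk using h
  rw [← periodization_add_int f x k]
  exact congrArg _ (funext hk)

variable [Fintype ι]

lemma measurableSet_unitCube (m : ι → ℤ) : MeasurableSet (unitCube m) :=
  MeasurableSet.univ_pi' fun _ => measurableSet_Ioc

/-- The integral over the cube at `m` is the integral over the cube at `0` of the translate. -/
lemma setIntegral_unitCube (f : (ι → ℝ) → ℂ) (m : ι → ℤ) :
    ∫ x in unitCube m, f x = ∫ x in unitCube 0, f (x + fun i => (m i : ℝ)) := by
  have h := (measurePreserving_add_right (volume : Measure (ι → ℝ))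
    (fun i => (m i : ℝ))).setIntegral_preimage_emb
    (MeasurableEquiv.addRight (fun i => (m i : ℝ))).measurableEmbedding f (unitCube m)
  rw [← h]
  congr 2
  ext x
  simp only [unitCube, mem_preimage, mem_ofPred_eq, Pi.add_apply, mem_Ioc, Pi.zero_apply,
    Int.cast_zero]
  refine forall_congr' fun i => ?_
  constructor <;> rintro ⟨h1, h2⟩ <;> constructor <;> linarith

lemma hasSum_setIntegral_unitCube {f : (ι → ℝ) → ℂ} (hf : Integrable f) :
    HasSum (fun m : ι → ℤ => ∫ x in unitCube 0, f (x + fun i => (m i : ℝ))) (∫ x, f x) := by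
  have h := hasSum_integral_iUnion (μ := (volume : Measure (ι → ℝ))) (f := f)
    (fun m : ι → ℤ => measurableSet_unitCube m) pairwise_disjoint_unitCube
    (by rw [iUnion_unitCube]; exact hf.integrableOn)
  rw [iUnion_unitCube, Measure.restrict_univ] at h
  simpa only [setIntegral_unitCube f] using h

/-- Only finitely many integer translates of a compactly supported function meet a given ball;
on the ball, they are dominated by a summable family. -/
lemma exists_summable_bound_translates {f : (ι → ℝ) → ℂ} (hf : Continuous f)
    (hc : HasCompactSupport f) (M : ℝ) :
    ∃ u : (ι → ℤ) → ℝ, Summable u ∧ ∀ (m : ι → ℤ) (x : ι → ℝ), x ∈ Metric.closedBall 0 M →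
      ‖f (x + fun i => (m i : ℝ))‖ ≤ u m := by
  obtain ⟨C, hC⟩ := hc.exists_bound_of_continuous hf
  obtain ⟨K, hK⟩ := hc.isCompact.isBounded.subset_closedBall (0 : ι → ℝ)
  have hfin : (Metric.closedBall (0 : ι → ℤ) (K + M)).Finite :=
    (isCompact_closedBall _ _).finite_of_discrete
  refine ⟨(Metric.closedBall (0 : ι → ℤ) (K + M)).indicator fun _ => C,
    summable_of_hasFiniteSupport (hfin.subset support_indicator_subset), fun m x hx => ?_⟩
  by_cases hm : m ∈ Metric.closedBall (0 : ι → ℤ) (K + M)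
  · rw [indicator_of_mem hm]
    exact hC _
  · rw [indicator_of_notMem hm, norm_le_zero_iff]
    by_contra hne
    have h1 := hK (subset_tsupport f hne)
    apply hm
    rw [mem_closedBall_zero_iff] at h1 hx ⊢
    have h2 : ‖m‖ = ‖fun i => (m i : ℝ)‖ := by
      simp only [Pi.norm_def, nnnorm, Int.norm_cast_real]
    rw [h2]
    calc ‖fun i => (m i : ℝ)‖ = ‖(x + fun i => (m i : ℝ)) - x‖ := by simp
      _ ≤ ‖x + fun i => (m i : ℝ)‖ + ‖x‖ := norm_sub_le _ _
      _ ≤ K + M := add_le_add h1 hx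

lemma continuous_periodization {f : (ι → ℝ) → ℂ} (hf : Continuous f)
    (hc : HasCompactSupport f) : Continuous (periodization f) := by
  refine continuous_iff_continuousAt.2 fun x => ?_
  obtain ⟨u, hu, hfu⟩ := exists_summable_bound_translates hf hc (‖x‖ + 1)
  refine ContinuousOn.continuousAt (s := Metric.closedBall 0 (‖x‖ + 1))
    (continuousOn_tsum (fun m => by fun_prop) hu hfu) ?_
  exact Metric.closedBall_mem_nhds_of_mem (by simp)

/-- The character `x ↦ exp (-2πi n·x)`. -/
def wave (n : ι → ℤ) (x : ι → ℝ) : ℂ :=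
  Complex.exp (-(2 * Real.pi * ∑ i, n i * x i : ℝ) * Complex.I)

lemma norm_wave (n : ι → ℤ) (x : ι → ℝ) : ‖wave n x‖ = 1 := by
  rw [wave, ← Complex.ofReal_neg, Complex.norm_exp_ofReal_mul_I]

lemma continuous_wave (n : ι → ℤ) : Continuous (wave n) := by
  unfold wave; fun_prop

lemma mFourier_neg_coe (n : ι → ℤ) (x : ι → ℝ) :
    UnitAddTorus.mFourier (-n) (fun i => (x i : UnitAddCircle)) = wave n x := by
  simp only [UnitAddTorus.mFourier, ContinuousMap.coe_mk, fourier_coe_apply, wave,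
    ← Complex.exp_sum]
  congr 1
  push_cast
  rw [Finset.mul_sum, ← Finset.sum_neg_distrib, Finset.sum_mul]
  refine Finset.sum_congr rfl fun i _ => ?_
  simp
  ring

lemma wave_add_int (n : ι → ℤ) (x : ι → ℝ) (k : ι → ℤ) :
    wave n (x + fun i => (k i : ℝ)) = wave n x := by
  rw [← mFourier_neg_coe, ← mFourier_neg_coe]
  congr 1
  ext i
  simp

/-- The periodization of `f`, as a continuous function on the torus. -/
def torusPeriodization {f : (ι → ℝ) → ℂ} (hf : Continuous f) (hc : HasCompactSupport f) :
    C(UnitAddTorus ι, ℂ) where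
  toFun y := periodization f fun i => (y i).out
  continuous_toFun := by
    have hq : IsOpenQuotientMap
        (Pi.map fun (_ : ι) (t : ℝ) => (t : UnitAddCircle)) :=
      IsOpenQuotientMap.piMap fun _ => QuotientAddGroup.isOpenQuotientMap_mk
    rw [hq.isQuotientMap.continuous_iff]
    convert continuous_periodization hf hc using 1
    ext x
    exact periodization_out f x

lemma torusPeriodization_coe {f : (ι → ℝ) → ℂ} (hf : Continuous f) (hc : HasCompactSupport f)
    (x : ι → ℝ) : torusPeriodization hf hc (fun i => (x i : UnitAddCircle)) = periodization f x :=
  periodization_out f x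

lemma mFourierCoeff_torusPeriodization {f : (ι → ℝ) → ℂ} (hf : Continuous f)
    (hc : HasCompactSupport f) (n : ι → ℤ) :
    UnitAddTorus.mFourierCoeff (torusPeriodization hf hc) n = ∫ x, wave n x * f x := by
  rw [UnitAddTorus.mFourierCoeff_eq_integral _ _ 0]
  have hint : Integrable fun x => wave n x * f x :=
    Continuous.integrable_of_hasCompactSupport ((continuous_wave n).mul hf) hc.mul_left
  rw [← (hasSum_setIntegral_unitCube hint).tsum_eq]
  have hcube : {x : ι → ℝ | ∀ i, x i ∈ Ioc ((0 : ι → ℝ) i) ((0 : ι → ℝ) i + 1)} = unitCube 0 := by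
    simp [unitCube]
  rw [hcube]
  obtain ⟨u, hu, hfu⟩ := exists_summable_bound_translates hf hc 1
  have hb : ∀ x ∈ unitCube (0 : ι → ℤ), x ∈ Metric.closedBall (0 : ι → ℝ) 1 := by
    intro x hx
    rw [mem_closedBall_zero_iff, pi_norm_le_iff_of_nonneg zero_le_one]
    intro i
    have := hx i
    simp only [Pi.zero_apply, Int.cast_zero, zero_add, mem_Ioc] at this
    rw [Real.norm_eq_abs, abs_le]
    constructor <;> linarith
  have hvol : (volume.restrict (unitCube (0 : ι → ℤ))) univ < ⊤ := by
    rw [Measure.restrict_apply_univ]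
    exact (measure_mono hb).trans_lt (isCompact_closedBall _ _).measure_lt_top
  have : IsFiniteMeasure (volume.restrict (unitCube (0 : ι → ℤ))) := ⟨hvol⟩
  have hi : ∀ m : ι → ℤ, IntegrableOn
      (fun x => wave n (x + fun i => (m i : ℝ)) * f (x + fun i => (m i : ℝ))) (unitCube 0) :=
    fun m => (hint.comp_add_right fun i => (m i : ℝ)).integrableOn
  rw [integral_tsum_of_summable_integral_norm hi]
  · refine setIntegral_congr_fun (measurableSet_unitCube 0) fun x _ => ?_
    simp only [mFourier_neg_coe, torusPeriodization_coe, smul_eq_mul, periodization, wave_add_int]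
    exact tsum_mul_left.symm
  · refine Summable.of_nonneg_of_le (fun m => integral_nonneg fun _ => norm_nonneg _)
      (fun m => ?_) (hu.mul_left (volume.real (unitCube (0 : ι → ℤ))))
    have h1 : ∫ x in unitCube (0 : ι → ℤ),
        ‖wave n (x + fun i => (m i : ℝ)) * f (x + fun i => (m i : ℝ))‖
          ≤ ∫ x in unitCube (0 : ι → ℤ), u m := by
      refine setIntegral_mono_on (hi m).norm (integrable_const _) (measurableSet_unitCube 0)
        fun x hx => ?_
      rw [norm_mul, norm_wave, one_mul]
      exact hfu m x (hb x hx)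
    simpa using h1

/-- **Poisson summation** for continuous functions of compact support. -/
theorem hasSum_integral_wave_mul {f : (ι → ℝ) → ℂ} (hf : Continuous f) (hc : HasCompactSupport f)
    (hs : Summable fun n : ι → ℤ => ∫ x, wave n x * f x) :
    HasSum (fun n : ι → ℤ => ∫ x, wave n x * f x) (∑' m : ι → ℤ, f fun i => (m i : ℝ)) := by
  have h := UnitAddTorus.hasSum_mFourier_series_apply_of_summable
    (f := torusPeriodization hf hc)
    (by rwa [funext (mFourierCoeff_torusPeriodization hf hc)])
    (fun i => ((0 : ℝ) : UnitAddCircle))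
  have h0 := torusPeriodization_coe hf hc 0
  simp only [Pi.zero_apply] at h0
  rw [h0] at h
  have h1 : ∀ n : ι → ℤ, UnitAddTorus.mFourier n (fun _ => ((0 : ℝ) : UnitAddCircle)) = 1 := by
    intro n
    have := mFourier_neg_coe (-n) 0
    simp only [neg_neg, Pi.zero_apply] at this
    rw [this]
    simp [wave]
  simpa only [mFourierCoeff_torusPeriodization, h1, smul_eq_mul, mul_one, periodization, zero_add]
    using h

end Poisson

/-! ### Asymptotic expansion of the Fourier transform of `(1 - s²)^{3/2}` -/

section Bessel

open MeasureTheory Set Filter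

/-- The Fourier transform `∫_{-1}^1 (1 - s²)^{3/2} cos (z s) ds`. It equals `3π z⁻² J₂(z)` by
Poisson's integral for the Bessel function `J₂`. -/
def besselInt (z : ℝ) : ℝ := ∫ s in (-1 : ℝ)..1, (1 - s ^ 2) ^ (3 / 2 : ℝ) * Real.cos (z * s)

/-- The function `(t - 2i)^{3/2}`, with the principal branch. On the vertical half line `s = 1 + it`
one has `1 - s² = t (t - 2i)`, so `(1 - s²)^{3/2}` is `t^{3/2}` times this function. -/
def sideFactor (t : ℝ) : ℂ := ((t : ℂ) - 2 * Complex.I) ^ ((3 / 2 : ℝ) : ℂ)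

/-- The integral of `(1 - s²)^{3/2} e^{izs}` up the vertical half line at `1`, without the
factor `i e^{iz}`. -/
def sideIntegral (z : ℝ) : ℂ :=
  ∫ t in Ioi (0 : ℝ), ((t ^ (3 / 2 : ℝ) * Real.exp (-(z * t)) : ℝ) : ℂ) * sideFactor t

lemma sub_two_I_mem_slitPlane (t : ℝ) : (t : ℂ) - 2 * Complex.I ∈ Complex.slitPlane := by
  rw [Complex.mem_slitPlane_iff]
  right
  simp

lemma contDiff_sideFactor {n : WithTop ℕ∞} : ContDiff ℝ n sideFactor := by
  have h : sideFactor =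
      fun t : ℝ => Complex.exp (Complex.log ((t : ℂ) - 2 * Complex.I) * ((3 / 2 : ℝ) : ℂ)) := by
    ext t
    rw [sideFactor, Complex.cpow_def_of_ne_zero (Complex.slitPlane_ne_zero
      (sub_two_I_mem_slitPlane t))]
  rw [h]
  refine contDiff_iff_contDiffAt.2 fun t => ?_
  refine ContDiffAt.cexp (ContDiffAt.mul ?_ contDiffAt_const)
  refine ContDiffAt.comp (𝕜 := ℝ) (g := Complex.log) (f := fun t : ℝ => (t : ℂ) - 2 * Complex.I) t
    ((Complex.contDiffAt_log (sub_two_I_mem_slitPlane t)).restrict_scalars ℝ) ?_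
  exact (Complex.ofRealCLM.contDiff.sub contDiff_const).contDiffAt

lemma norm_sideFactor_le {t : ℝ} (ht : 0 ≤ t) : ‖sideFactor t‖ ≤ 8 * (1 + t ^ 2) := by
  rw [sideFactor, Complex.norm_cpow_real]
  have h1 : ‖(t : ℂ) - 2 * Complex.I‖ ≤ t + 2 := by
    refine (norm_sub_le _ _).trans ?_
    simp [abs_of_nonneg ht]
  calc ‖(t : ℂ) - 2 * Complex.I‖ ^ (3 / 2 : ℝ) ≤ (t + 2) ^ (3 / 2 : ℝ) := by gcongr
    _ ≤ (t + 2) ^ (2 : ℝ) := Real.rpow_le_rpow_of_exponent_le (by linarith) (by norm_num)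
    _ = (t + 2) ^ 2 := Real.rpow_two _
    _ ≤ _ := by nlinarith [sq_nonneg (t - 1)]

/-- Taylor expansion of `sideFactor` at `0`, with a remainder valid on the whole half line: Taylor's
theorem gives `t ^ n` on `[0, 1]`, and for `t ≥ 1` all terms are crudely bounded by `t ^ (n + 2)`. -/
lemma exists_taylor_sideFactor : ∃ c : ℕ → ℂ, c 0 = sideFactor 0 ∧ ∀ n : ℕ, ∃ C : ℝ, 0 ≤ C ∧
    ∀ t : ℝ, 0 ≤ t →
      ‖sideFactor t - ∑ k ∈ Finset.range n, c k * (t : ℂ) ^ k‖ ≤ C * (t ^ n + t ^ (n + 2)) := by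
  set c : ℕ → ℂ := fun k => ((k.factorial : ℝ)⁻¹ : ℝ) •
    iteratedDerivWithin k sideFactor (Icc 0 1) 0 with hc
  refine ⟨c, by simp [hc], fun n => ?_⟩
  obtain ⟨C, hC⟩ : ∃ C : ℝ, ∀ t ∈ Icc (0 : ℝ) 1,
      ‖sideFactor t - ∑ k ∈ Finset.range n, c k * (t : ℂ) ^ k‖ ≤ C * t ^ n := by
    cases n with
    | zero =>
      refine ⟨16, fun t ht => ?_⟩
      have := norm_sideFactor_le ht.1
      simp only [Finset.range_zero, Finset.sum_empty, sub_zero, pow_zero]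
      nlinarith [ht.1, ht.2]
    | succ n =>
      obtain ⟨C, hC⟩ := exists_taylor_mean_remainder_bound (f := sideFactor) (n := n)
        (zero_le_one' ℝ) contDiff_sideFactor.contDiffOn
      refine ⟨C, fun t ht => ?_⟩
      have := hC t ht
      rw [taylor_within_apply] at this
      simp only [sub_zero] at this
      have h2 : ∀ k, c k * (t : ℂ) ^ k =
          (((k.factorial : ℝ)⁻¹ * t ^ k : ℝ)) • iteratedDerivWithin k sideFactor (Icc 0 1) 0 := by
        intro k
        simp only [hc, Complex.real_smul]
        push_cast
        ring
      simpa only [h2] using this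
  refine ⟨|C| + (16 + ∑ k ∈ Finset.range n, ‖c k‖), by positivity, fun t ht => ?_⟩
  rcases le_total t 1 with h1 | h1
  · calc _ ≤ C * t ^ n := hC t ⟨ht, h1⟩
      _ ≤ |C| * t ^ n + 0 + 0 := by nlinarith [le_abs_self C, pow_nonneg ht n]
      _ ≤ |C| * t ^ n + |C| * t ^ (n + 2) +
          (16 + ∑ k ∈ Finset.range n, ‖c k‖) * (t ^ n + t ^ (n + 2)) := by gcongr <;> positivity
      _ = _ := by ring
  · have h2 : ‖sideFactor t‖ ≤ 16 * t ^ (n + 2) := by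
      have h3 : t ^ 2 ≤ t ^ (n + 2) := pow_le_pow_right₀ h1 (by omega)
      have := norm_sideFactor_le ht
      nlinarith
    have h4 : ‖∑ k ∈ Finset.range n, c k * (t : ℂ) ^ k‖ ≤
        (∑ k ∈ Finset.range n, ‖c k‖) * t ^ (n + 2) := by
      rw [Finset.sum_mul]
      refine norm_sum_le_of_le _ fun k hk => ?_
      rw [norm_mul, norm_pow, Complex.norm_real, Real.norm_eq_abs, abs_of_nonneg ht]
      have : k ≤ n + 2 := by have := Finset.mem_range.1 hk; omega
      gcongr
    calc _ ≤ ‖sideFactor t‖ + ‖∑ k ∈ Finset.range n, c k * (t : ℂ) ^ k‖ := norm_sub_le _ _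
      _ ≤ 16 * t ^ (n + 2) + (∑ k ∈ Finset.range n, ‖c k‖) * t ^ (n + 2) := add_le_add h2 h4
      _ = 0 + (16 + ∑ k ∈ Finset.range n, ‖c k‖) * (0 + t ^ (n + 2)) := by ring
      _ ≤ |C| * (t ^ n + t ^ (n + 2)) +
          (16 + ∑ k ∈ Finset.range n, ‖c k‖) * (t ^ n + t ^ (n + 2)) := by
        gcongr <;> positivity
      _ = _ := by ring

lemma integrableOn_rpow_mul_exp_neg {p z : ℝ} (hp : 0 ≤ p) (hz : 0 < z) :
    IntegrableOn (fun t : ℝ => t ^ p * Real.exp (-(z * t))) (Ioi 0) := by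
  have := integrableOn_rpow_mul_exp_neg_mul_rpow (p := 1) (s := p) (b := z) (by linarith) one_pos hz
  simpa using this

lemma integral_rpow_mul_exp_neg {p z : ℝ} (hp : 0 ≤ p) (hz : 0 < z) :
    ∫ t in Ioi (0 : ℝ), t ^ p * Real.exp (-(z * t)) = Real.Gamma (p + 1) * z ^ (-(p + 1)) := by
  have := Real.integral_rpow_mul_exp_neg_mul_Ioi (a := p + 1) (r := z) (by linarith) hz
  rw [add_sub_cancel_right] at this
  rw [this, Real.rpow_neg hz.le, one_div, Real.inv_rpow hz.le, mul_comm]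

lemma weight_mul_pow {t z : ℝ} (ht : 0 ≤ t) (k : ℕ) :
    t ^ (3 / 2 : ℝ) * Real.exp (-(z * t)) * t ^ k =
      t ^ (3 / 2 + k : ℝ) * Real.exp (-(z * t)) := by
  rw [Real.rpow_add_natCast' ht (by positivity)]
  ring

/-- Watson's lemma for `sideIntegral`: the Taylor expansion of `sideFactor` is integrated term by
term against `t^{3/2} e^{-zt}`. -/
lemma exists_expansion_sideIntegral : ∃ α : ℕ → ℂ,
    α 0 = sideFactor 0 * (Real.Gamma (5 / 2) : ℝ) ∧ ∀ n : ℕ, ∃ C : ℝ, 0 ≤ C ∧ ∀ z : ℝ, 0 < z →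
      ‖sideIntegral z - ∑ k ∈ Finset.range n, α k * ((z ^ (-(5 / 2 + k : ℝ)) : ℝ) : ℂ)‖ ≤
        C * (z ^ (-(5 / 2 + n : ℝ)) + z ^ (-(9 / 2 + n : ℝ))) := by
  obtain ⟨c, hc0, hc⟩ := exists_taylor_sideFactor
  refine ⟨fun k => c k * (Real.Gamma (5 / 2 + k) : ℝ), by simp [hc0], fun n => ?_⟩
  obtain ⟨C, hC0, hC⟩ := hc n
  have hΓ1 : 0 < Real.Gamma (5 / 2 + n) := Real.Gamma_pos_of_pos (by positivity)
  have hΓ2 : 0 < Real.Gamma (9 / 2 + n) := Real.Gamma_pos_of_pos (by positivity)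
  refine ⟨C * (Real.Gamma (5 / 2 + n) + Real.Gamma (9 / 2 + n)), by positivity, fun z hz => ?_⟩
  set w : ℝ → ℝ := fun t => t ^ (3 / 2 : ℝ) * Real.exp (-(z * t)) with hw
  have hwpow : ∀ k : ℕ, ∀ t ∈ Ioi (0 : ℝ), w t * t ^ k =
      t ^ (3 / 2 + k : ℝ) * Real.exp (-(z * t)) := fun k t ht => weight_mul_pow (le_of_lt ht) k
  have hint : ∀ k : ℕ, IntegrableOn (fun t => w t * t ^ k) (Ioi 0) := fun k =>
    (integrableOn_rpow_mul_exp_neg (by positivity) hz).congr_fun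
      (fun t ht => (hwpow k t ht).symm) measurableSet_Ioi
  have hval : ∀ k : ℕ, ∫ t in Ioi (0 : ℝ), w t * t ^ k =
      Real.Gamma (5 / 2 + k) * z ^ (-(5 / 2 + k : ℝ)) := by
    intro k
    rw [setIntegral_congr_fun measurableSet_Ioi (hwpow k),
      integral_rpow_mul_exp_neg (by positivity) hz]
    ring_nf
  have hwc : Continuous w := by
    rw [hw]
    exact (Real.continuous_rpow_const (by norm_num)).mul (by fun_prop)
  have hintC : ∀ k : ℕ, IntegrableOn (fun t => (w t : ℂ) * (c k * (t : ℂ) ^ k)) (Ioi 0) := by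
    intro k
    have := ((hint k).ofReal (𝕜 := ℂ)).const_mul (c k)
    refine this.congr (ae_of_all _ fun t => ?_)
    change c k * ((w t * t ^ k : ℝ) : ℂ) = _
    push_cast
    ring
  have hvalC : ∀ k : ℕ, ∫ t in Ioi (0 : ℝ), (w t : ℂ) * (c k * (t : ℂ) ^ k) =
      c k * (Real.Gamma (5 / 2 + k) : ℝ) * ((z ^ (-(5 / 2 + k : ℝ)) : ℝ) : ℂ) := by
    intro k
    rw [mul_assoc, ← Complex.ofReal_mul, ← hval k, ← integral_complex_ofReal,
      ← integral_const_mul]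
    congr 1
    ext t
    push_cast
    ring
  have hdom : IntegrableOn (fun t => C * (w t * t ^ n + w t * t ^ (n + 2))) (Ioi 0) :=
    ((hint n).add (hint (n + 2))).const_mul C
  have hbound : ∀ t ∈ Ioi (0 : ℝ),
      ‖(w t : ℂ) * (sideFactor t - ∑ k ∈ Finset.range n, c k * (t : ℂ) ^ k)‖ ≤
        C * (w t * t ^ n + w t * t ^ (n + 2)) := by
    intro t ht
    have ht' : (0 : ℝ) ≤ t := le_of_lt ht
    have hw0 : 0 ≤ w t := by rw [hw]; positivity
    rw [norm_mul, Complex.norm_real, Real.norm_eq_abs, abs_of_nonneg hw0]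
    calc _ ≤ w t * (C * (t ^ n + t ^ (n + 2))) := by gcongr; exact hC t ht'
      _ = _ := by ring
  have hcont : Continuous fun t : ℝ =>
      (w t : ℂ) * (sideFactor t - ∑ k ∈ Finset.range n, c k * (t : ℂ) ^ k) := by
    have := (contDiff_sideFactor (n := 0)).continuous
    fun_prop
  have hrem : IntegrableOn (fun t : ℝ =>
      (w t : ℂ) * (sideFactor t - ∑ k ∈ Finset.range n, c k * (t : ℂ) ^ k)) (Ioi 0) :=
    Integrable.mono' hdom hcont.aestronglyMeasurable
      ((ae_restrict_mem measurableSet_Ioi).mono hbound)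
  have hsplit : sideIntegral z -
      ∑ k ∈ Finset.range n, c k * (Real.Gamma (5 / 2 + k) : ℝ) *
        ((z ^ (-(5 / 2 + k : ℝ)) : ℝ) : ℂ) =
      ∫ t in Ioi (0 : ℝ),
        (w t : ℂ) * (sideFactor t - ∑ k ∈ Finset.range n, c k * (t : ℂ) ^ k) := by
    rw [sub_eq_iff_eq_add, ← Finset.sum_congr rfl fun k _ => hvalC k,
      ← integral_finsetSum _ fun k _ => hintC k,
      ← integral_add hrem (integrable_finsetSum _ fun k _ => hintC k), sideIntegral]
    congr 1
    ext t
    rw [← Finset.mul_sum]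
    ring
  rw [hsplit]
  calc _ ≤ ∫ t in Ioi (0 : ℝ), C * (w t * t ^ n + w t * t ^ (n + 2)) :=
        norm_integral_le_of_norm_le hdom ((ae_restrict_mem measurableSet_Ioi).mono hbound)
    _ = C * (Real.Gamma (5 / 2 + n) * z ^ (-(5 / 2 + n : ℝ)) +
          Real.Gamma (9 / 2 + n) * z ^ (-(9 / 2 + n : ℝ))) := by
        rw [integral_const_mul, integral_add (hint n) (hint (n + 2)), hval, hval]
        push_cast
        ring_nf
    _ ≤ _ := by
        have h1 : 0 < z ^ (-(5 / 2 + n : ℝ)) := by positivity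
        have h2 : 0 < z ^ (-(9 / 2 + n : ℝ)) := by positivity
        have := mul_pos hΓ1 h2
        have := mul_pos hΓ2 h1
        rw [mul_assoc]
        gcongr
        nlinarith

/-- The analytic integrand `(1 - s²)^{3/2} e^{izs}` with the principal branch, which is analytic in
the half strip `|Re s| < 1`, `Im s > 0`. -/
def stripIntegrand (z : ℝ) (s : ℂ) : ℂ :=
  (1 - s ^ 2) ^ ((3 / 2 : ℝ) : ℂ) * Complex.exp (Complex.I * z * s)

lemma one_sub_sq_re_im (s : ℂ) :
    (1 - s ^ 2).re = 1 - s.re ^ 2 + s.im ^ 2 ∧ (1 - s ^ 2).im = -(2 * s.re * s.im) := by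
  simp only [pow_two, Complex.sub_re, Complex.sub_im, Complex.mul_re, Complex.mul_im,
    Complex.one_re, Complex.one_im]
  constructor <;> ring

/-- Continuity includes the corners `±1`, where `1 - s²` vanishes: `Re (1 - s²) ≥ 0` on the closed
rectangle, and a power with positive exponent is continuous at `0` too. -/
lemma continuousOn_stripIntegrand (z Y : ℝ) :
    ContinuousOn (stripIntegrand z) (Icc (-1) 1 ×ℂ Icc 0 Y) := by
  refine ContinuousOn.mul ?_ (by fun_prop)
  intro s hs
  have hs1 := (Complex.mem_reProdIm.1 hs).1
  have h : ContinuousAt (fun w : ℂ => w ^ ((3 / 2 : ℝ) : ℂ)) (1 - s ^ 2) := by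
    refine Complex.continuousAt_cpow_const_of_re_pos (Or.inl ?_) ?_
    · rw [(one_sub_sq_re_im s).1]
      nlinarith [hs1.1, hs1.2, sq_nonneg s.im]
    · rw [Complex.ofReal_re]
      norm_num
  exact (ContinuousAt.comp (f := fun s : ℂ => 1 - s ^ 2) h (by fun_prop)).continuousWithinAt

lemma differentiableOn_stripIntegrand (z Y : ℝ) :
    DifferentiableOn ℂ (stripIntegrand z) (Ioo (-1) 1 ×ℂ Ioo 0 Y) := by
  intro s hs
  have hs1 := (Complex.mem_reProdIm.1 hs).1
  refine DifferentiableAt.differentiableWithinAt (DifferentiableAt.mul ?_ (by fun_prop))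
  refine DifferentiableAt.cpow (by fun_prop) (by fun_prop) ?_
  rw [Complex.mem_slitPlane_iff]
  left
  rw [(one_sub_sq_re_im s).1]
  nlinarith [hs1.1, hs1.2, sq_nonneg s.im]

lemma stripIntegrand_one_add {z t : ℝ} (ht : 0 < t) :
    stripIntegrand z ((1 : ℝ) + t * Complex.I) = Complex.exp (Complex.I * z) *
      (((t ^ (3 / 2 : ℝ) * Real.exp (-(z * t)) : ℝ) : ℂ) * sideFactor t) := by
  have h1 : 1 - (((1 : ℝ) : ℂ) + t * Complex.I) ^ 2 = (t : ℂ) * ((t : ℂ) - 2 * Complex.I) := by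
    push_cast
    linear_combination -(t : ℂ) ^ 2 * Complex.I_sq
  have hne := Complex.slitPlane_ne_zero (sub_two_I_mem_slitPlane t)
  have ht0 : (t : ℂ) ≠ 0 := Complex.ofReal_ne_zero.2 ht.ne'
  have h2 : ((t : ℂ) * ((t : ℂ) - 2 * Complex.I)) ^ ((3 / 2 : ℝ) : ℂ) =
      (t : ℂ) ^ ((3 / 2 : ℝ) : ℂ) * sideFactor t := by
    rw [sideFactor, Complex.cpow_def_of_ne_zero (mul_ne_zero ht0 hne),
      Complex.cpow_def_of_ne_zero ht0, Complex.cpow_def_of_ne_zero hne,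
      Complex.log_ofReal_mul ht hne, Complex.ofReal_log ht.le, add_mul, Complex.exp_add]
  have h3 : Complex.exp (Complex.I * z * (((1 : ℝ) : ℂ) + t * Complex.I)) =
      Complex.exp (Complex.I * z) * ((Real.exp (-(z * t)) : ℝ) : ℂ) := by
    rw [Complex.ofReal_exp, ← Complex.exp_add]
    congr 1
    push_cast
    linear_combination (z : ℂ) * t * Complex.I_sq
  rw [stripIntegrand, h1, h2, h3, Complex.ofReal_mul, Complex.ofReal_cpow ht.le]
  ring

lemma stripIntegrand_neg_one_add {z t : ℝ} (ht : 0 < t) :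
    stripIntegrand z ((-1 : ℝ) + t * Complex.I) =
      (starRingEnd ℂ) (stripIntegrand z ((1 : ℝ) + t * Complex.I)) := by
  have h1 : 1 - (((-1 : ℝ) : ℂ) + t * Complex.I) ^ 2 =
      (starRingEnd ℂ) (1 - (((1 : ℝ) : ℂ) + t * Complex.I) ^ 2) := by
    simp only [map_sub, map_one, map_pow, map_add, map_mul, Complex.conj_ofReal, Complex.conj_I]
    push_cast
    ring
  have h2 : (1 - (((1 : ℝ) : ℂ) + t * Complex.I) ^ 2).arg ≠ Real.pi := by
    intro h
    have := (Complex.arg_eq_pi_iff.1 h).2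
    rw [(one_sub_sq_re_im _).2] at this
    simp at this
    exact ht.ne' this
  rw [stripIntegrand, stripIntegrand, h1, Complex.conj_cpow _ _ h2, map_mul, ← Complex.exp_conj]
  simp only [map_add, map_mul, Complex.conj_ofReal, Complex.conj_I]
  congr 2
  push_cast
  ring

lemma norm_stripIntegrand_le {z x Y : ℝ} (hx : x ∈ Icc (-1 : ℝ) 1) (hY : 1 ≤ Y) :
    ‖stripIntegrand z (x + Y * Complex.I)‖ ≤ 9 * (Y ^ (4 : ℝ) * Real.exp (-z * Y)) := by
  have h1 : ‖1 - ((x : ℂ) + Y * Complex.I) ^ 2‖ ≤ 3 * Y ^ 2 := by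
    have h2 : ‖(x : ℂ) + Y * Complex.I‖ ^ 2 = x ^ 2 + Y ^ 2 := by
      rw [Complex.sq_norm, Complex.normSq_add_mul_I]
    calc _ ≤ ‖(1 : ℂ)‖ + ‖((x : ℂ) + Y * Complex.I) ^ 2‖ := norm_sub_le _ _
      _ = 1 + (x ^ 2 + Y ^ 2) := by rw [norm_one, norm_pow, h2]
      _ ≤ _ := by nlinarith [hx.1, hx.2]
  have h3 : ‖Complex.exp (Complex.I * z * (x + Y * Complex.I))‖ = Real.exp (-z * Y) := by
    rw [Complex.norm_exp]
    simp
  rw [stripIntegrand, norm_mul, h3, Complex.norm_cpow_real, ← mul_assoc]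
  gcongr
  calc ‖1 - ((x : ℂ) + Y * Complex.I) ^ 2‖ ^ (3 / 2 : ℝ) ≤ (3 * Y ^ 2) ^ (3 / 2 : ℝ) := by gcongr
    _ ≤ (3 * Y ^ 2) ^ (2 : ℝ) := Real.rpow_le_rpow_of_exponent_le (by nlinarith) (by norm_num)
    _ = 9 * Y ^ (4 : ℝ) := by
      rw [Real.rpow_two, show (4 : ℝ) = ((4 : ℕ) : ℝ) by norm_num, Real.rpow_natCast]
      ring

lemma integral_stripIntegrand_re (z : ℝ) :
    (∫ x in (-1 : ℝ)..1, stripIntegrand z (x + (0 : ℝ) * Complex.I)).re = besselInt z := by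
  have hc : ContinuousOn (fun x : ℝ => stripIntegrand z (x + (0 : ℝ) * Complex.I))
      (uIcc (-1) 1) := by
    rw [uIcc_of_le (by norm_num)]
    refine (continuousOn_stripIntegrand z 0).comp (by fun_prop) fun x hx => ?_
    rw [Complex.mem_reProdIm]
    simpa using hx
  have h := Complex.reCLM.intervalIntegral_comp_comm (μ := volume) hc.intervalIntegrable
  simp only [Complex.reCLM_apply] at h
  rw [← h, besselInt]
  refine intervalIntegral.integral_congr fun x hx => ?_
  rw [uIcc_of_le (by norm_num)] at hx
  have h1 : 0 ≤ 1 - x ^ 2 := by nlinarith [hx.1, hx.2]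
  have h2 : (1 : ℂ) - (x : ℂ) ^ 2 = ((1 - x ^ 2 : ℝ) : ℂ) := by push_cast; rfl
  have h3 : Complex.I * z * x = ((z * x : ℝ) : ℂ) * Complex.I := by push_cast; ring
  simp only [stripIntegrand, Complex.ofReal_zero, zero_mul, add_zero]
  rw [h2, h3, ← Complex.ofReal_cpow h1, Complex.re_ofReal_mul, Complex.exp_ofReal_mul_I_re]

/-- The contour shift: the integral over `[-1, 1]` is the difference of the integrals up the two
vertical half lines at `±1`, which are complex conjugates of each other. -/
lemma besselInt_eq {z : ℝ} (hz : 0 < z) :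
    besselInt z = 2 * (Complex.exp (Complex.I * z) * sideIntegral z).im := by
  set F : ℝ → ℂ := fun t => Complex.exp (Complex.I * z) *
      (((t ^ (3 / 2 : ℝ) * Real.exp (-(z * t)) : ℝ) : ℂ) * sideFactor t) with hF
  have hFint : IntegrableOn F (Ioi 0) := by
    have hdom : IntegrableOn (fun t : ℝ => 8 * (t ^ (3 / 2 : ℝ) * Real.exp (-(z * t)) +
        t ^ (3 / 2 + (2 : ℕ) : ℝ) * Real.exp (-(z * t)))) (Ioi 0) :=
      ((integrableOn_rpow_mul_exp_neg (by norm_num) hz).add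
        (integrableOn_rpow_mul_exp_neg (by norm_num) hz)).const_mul 8
    have hcont : Continuous F := by
      have := (contDiff_sideFactor (n := 0)).continuous
      have h2 := Real.continuous_rpow_const (q := 3 / 2) (by norm_num)
      fun_prop
    refine Integrable.mono' hdom hcont.aestronglyMeasurable
      ((ae_restrict_mem measurableSet_Ioi).mono fun t ht => ?_)
    have ht' : (0 : ℝ) ≤ t := le_of_lt ht
    rw [hF, norm_mul, norm_mul, mul_comm Complex.I, Complex.norm_exp_ofReal_mul_I, one_mul,
      Complex.norm_real, Real.norm_of_nonneg (by positivity), ← weight_mul_pow ht' 2]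
    calc _ ≤ t ^ (3 / 2 : ℝ) * Real.exp (-(z * t)) * (8 * (1 + t ^ 2)) := by
          gcongr
          exact norm_sideFactor_le ht'
      _ = _ := by ring
  -- The rectangle `[-1, 1] × [0, Y]` grows upwards: its top side contributes nothing in the limit.
  have hlim1 : Tendsto (fun Y : ℝ => ∫ t in (0 : ℝ)..Y, F t) atTop (𝓝 (∫ t in Ioi (0 : ℝ), F t)) :=
    intervalIntegral_tendsto_integral_Ioi 0 hFint tendsto_id
  have htop : Tendsto (fun Y : ℝ => ∫ x in (-1 : ℝ)..1, stripIntegrand z (x + Y * Complex.I))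
      atTop (𝓝 0) := by
    have h0 := ((tendsto_rpow_mul_exp_neg_mul_atTop_nhds_zero 4 z hz).const_mul 9).const_mul 2
    rw [mul_zero, mul_zero] at h0
    refine squeeze_zero_norm' ?_ h0
    filter_upwards [eventually_ge_atTop 1] with Y hY
    have := intervalIntegral.norm_integral_le_of_norm_le_const (a := -1) (b := 1)
      (f := fun x : ℝ => stripIntegrand z (x + Y * Complex.I))
      (C := 9 * (Y ^ (4 : ℝ) * Real.exp (-z * Y))) (fun x hx => norm_stripIntegrand_le
        (by rw [uIoc_of_le (by norm_num)] at hx; exact ⟨hx.1.le, hx.2⟩) hY)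
    refine this.trans (le_of_eq ?_)
    norm_num
    ring
  have hrect : ∀ Y : ℝ, 0 ≤ Y →
      (∫ x in (-1 : ℝ)..1, stripIntegrand z (x + (0 : ℝ) * Complex.I)) -
        (∫ x in (-1 : ℝ)..1, stripIntegrand z (x + Y * Complex.I)) =
      Complex.I * ((starRingEnd ℂ) (∫ t in (0 : ℝ)..Y, F t) - ∫ t in (0 : ℝ)..Y, F t) := by
    intro Y hY
    have h := Complex.integral_boundary_rect_eq_zero_of_continuousOn_of_differentiableOn
      (stripIntegrand z) (⟨-1, 0⟩ : ℂ) (⟨1, Y⟩ : ℂ)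
      (by
        simp only [uIcc_of_le hY, uIcc_of_le (show (-1 : ℝ) ≤ 1 by norm_num)]
        exact continuousOn_stripIntegrand z Y)
      (by
        simp only [min_eq_left hY, max_eq_right hY,
          min_eq_left (show (-1 : ℝ) ≤ 1 by norm_num), max_eq_right (show (-1 : ℝ) ≤ 1 by norm_num)]
        exact differentiableOn_stripIntegrand z Y)
    simp only at h
    have e1 : ∫ t in (0 : ℝ)..Y, stripIntegrand z ((1 : ℝ) + t * Complex.I) =
        ∫ t in (0 : ℝ)..Y, F t := by
      refine intervalIntegral.integral_congr_ae (ae_of_all _ fun t ht => ?_)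
      rw [uIoc_of_le hY] at ht
      exact stripIntegrand_one_add ht.1
    have e2 : ∫ t in (0 : ℝ)..Y, stripIntegrand z ((-1 : ℝ) + t * Complex.I) =
        (starRingEnd ℂ) (∫ t in (0 : ℝ)..Y, F t) := by
      rw [← intervalIntegral.intervalIntegral_conj]
      refine intervalIntegral.integral_congr_ae (ae_of_all _ fun t ht => ?_)
      rw [uIoc_of_le hY] at ht
      rw [stripIntegrand_neg_one_add ht.1, stripIntegrand_one_add ht.1]
    rw [e1, e2] at h
    simp only [smul_eq_mul] at h
    linear_combination h
  have hlim := ((tendsto_const_nhds (x := ∫ x in (-1 : ℝ)..1,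
    stripIntegrand z (x + (0 : ℝ) * Complex.I))).sub htop).congr'
      ((eventually_ge_atTop 0).mono hrect)
  have hlim2 : Tendsto (fun Y : ℝ => Complex.I * ((starRingEnd ℂ) (∫ t in (0 : ℝ)..Y, F t) -
      ∫ t in (0 : ℝ)..Y, F t)) atTop (𝓝 (Complex.I * ((starRingEnd ℂ) (∫ t in Ioi (0 : ℝ), F t) -
      ∫ t in Ioi (0 : ℝ), F t))) :=
    (((Complex.continuous_conj.tendsto _).comp hlim1).sub hlim1).const_mul _
  have heq := tendsto_nhds_unique hlim hlim2
  rw [← integral_stripIntegrand_re, ← sub_zero (∫ x in (-1 : ℝ)..1, _), heq]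
  have hG : ∫ t in Ioi (0 : ℝ), F t = Complex.exp (Complex.I * z) * sideIntegral z := by
    rw [hF, sideIntegral, integral_const_mul]
  rw [hG]
  simp
  ring

/-- The complete asymptotic expansion of `besselInt`. -/
lemma exists_expansion_besselInt : ∃ α : ℕ → ℂ,
    α 0 = sideFactor 0 * (Real.Gamma (5 / 2) : ℝ) ∧ ∀ n : ℕ, ∃ C : ℝ, 0 ≤ C ∧ ∀ z : ℝ, 0 < z →
      |besselInt z - ∑ k ∈ Finset.range n,
        2 * (Complex.exp (Complex.I * z) * α k).im * z ^ (-(5 / 2 + k : ℝ))| ≤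
        C * (z ^ (-(5 / 2 + n : ℝ)) + z ^ (-(9 / 2 + n : ℝ))) := by
  obtain ⟨α, h0, hα⟩ := exists_expansion_sideIntegral
  refine ⟨α, h0, fun n => ?_⟩
  obtain ⟨C, hC0, hC⟩ := hα n
  refine ⟨2 * C, by positivity, fun z hz => ?_⟩
  have h1 : besselInt z - ∑ k ∈ Finset.range n,
      2 * (Complex.exp (Complex.I * z) * α k).im * z ^ (-(5 / 2 + k : ℝ)) =
      2 * (Complex.exp (Complex.I * z) * (sideIntegral z -
        ∑ k ∈ Finset.range n, α k * ((z ^ (-(5 / 2 + k : ℝ)) : ℝ) : ℂ))).im := by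
    rw [besselInt_eq hz, mul_sub, Complex.sub_im, mul_sub, Finset.mul_sum, Complex.im_sum,
      Finset.mul_sum]
    congr 1
    refine Finset.sum_congr rfl fun k _ => ?_
    rw [← mul_assoc, Complex.im_mul_ofReal]
    ring
  rw [h1, abs_mul, abs_two, mul_assoc]
  refine mul_le_mul_of_nonneg_left ((Complex.abs_im_le_norm _).trans ?_) zero_le_two
  rw [norm_mul, mul_comm Complex.I, Complex.norm_exp_ofReal_mul_I, one_mul]
  exact hC z hz

/-- The first term of the expansion is `-3 √(2π) cos (z - π/4)`, since `(-2i)^{3/2}` is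
`2^{3/2} e^{-3πi/4}` and `Γ(5/2) = 3√π/4`. -/
lemma two_mul_im_exp_mul_sideFactor (z : ℝ) :
    2 * (Complex.exp (Complex.I * z) * (sideFactor 0 * (Real.Gamma (5 / 2) : ℝ))).im =
      -(3 * Real.sqrt 2 * Real.sqrt Real.pi) * Real.cos (z - Real.pi / 4) := by
  have hlog : Complex.log (((0 : ℝ) : ℂ) - 2 * Complex.I) =
      (Real.log 2 : ℝ) - (Real.pi / 2 : ℝ) * Complex.I := by
    have h : ((0 : ℝ) : ℂ) - 2 * Complex.I = ((2 : ℝ) : ℂ) * (-Complex.I) := by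
      push_cast; ring
    rw [h, Complex.log_ofReal_mul two_pos (neg_ne_zero.2 Complex.I_ne_zero), Complex.log_neg_I]
    push_cast
    ring
  have h2 : Real.exp (Real.log 2 * (3 / 2)) = 2 * Real.sqrt 2 := by
    rw [← Real.rpow_def_of_pos two_pos, show (3 / 2 : ℝ) = 1 + 1 / 2 by norm_num,
      Real.rpow_add two_pos, Real.rpow_one, Real.sqrt_eq_rpow]
  have hside : Complex.exp (Complex.I * z) * sideFactor 0 =
      ((2 * Real.sqrt 2 : ℝ) : ℂ) *
        Complex.exp (((z - Real.pi / 4 - Real.pi / 2 : ℝ) : ℂ) * Complex.I) := by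
    rw [sideFactor, Complex.cpow_def_of_ne_zero (Complex.slitPlane_ne_zero
      (sub_two_I_mem_slitPlane 0)), hlog, ← h2, Complex.ofReal_exp, ← Complex.exp_add,
      ← Complex.exp_add]
    congr 1
    push_cast
    ring
  have hΓ : Real.Gamma (5 / 2) = 3 / 4 * Real.sqrt Real.pi := by
    rw [show (5 / 2 : ℝ) = (1 / 2 + 1) + 1 by norm_num, Real.Gamma_add_one (by norm_num),
      Real.Gamma_add_one (by norm_num), Real.Gamma_one_half_eq]
    ring
  rw [← mul_assoc, Complex.im_mul_ofReal, hside, Complex.im_ofReal_mul,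
    Complex.exp_ofReal_mul_I_im, Real.sin_sub_pi_div_two, hΓ]
  ring

/-- The substitution `s = sin θ` turns the integral into that of `cos⁴ θ`. -/
lemma besselInt_zero : besselInt 0 = 3 * Real.pi / 8 := by
  have h1 := intervalIntegral.integral_comp_mul_deriv (a := -(Real.pi / 2)) (b := Real.pi / 2)
    (f := Real.sin) (f' := Real.cos) (g := fun s => (1 - s ^ 2) ^ (3 / 2 : ℝ))
    (fun x _ => Real.hasDerivAt_sin x) Real.continuous_cos.continuousOn
    ((Real.continuous_rpow_const (by norm_num)).comp (by fun_prop))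
  rw [Real.sin_neg, Real.sin_pi_div_two] at h1
  have h2 : ∫ x in -(Real.pi / 2)..Real.pi / 2,
      ((fun s : ℝ => (1 - s ^ 2) ^ (3 / 2 : ℝ)) ∘ Real.sin) x * Real.cos x =
      ∫ x in -(Real.pi / 2)..Real.pi / 2, Real.cos x ^ 4 := by
    refine intervalIntegral.integral_congr fun x hx => ?_
    rw [uIcc_of_le (by linarith [Real.pi_pos])] at hx
    have hcos : 0 ≤ Real.cos x := Real.cos_nonneg_of_mem_Icc hx
    have h3 : 1 - Real.sin x ^ 2 = Real.cos x ^ 2 := by rw [Real.cos_sq']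
    simp only [Function.comp_apply]
    rw [h3, ← Real.rpow_natCast_mul hcos, show ((2 : ℕ) : ℝ) * (3 / 2) = ((3 : ℕ) : ℝ) by norm_num,
      Real.rpow_natCast]
    ring
  simp only [besselInt, zero_mul, Real.cos_zero, mul_one]
  rw [← h1, h2, integral_cos_pow, integral_cos_sq]
  simp [Real.cos_neg, Real.sin_neg]
  ring

end Bessel

/-! ### The Fourier transform of a truncated paraboloid over an ellipse -/

section Transform

open MeasureTheory Set Filter

lemma abs_lt_sqrt_of_sq_lt {x y : ℝ} (h : x ^ 2 < y) : |x| < Real.sqrt y := by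
  rwa [Real.lt_sqrt (abs_nonneg x), sq_abs]

lemma integral_max_sub_sq (c : ℝ) :
    ∫ y : ℝ, max (c - y ^ 2) 0 = 4 / 3 * max c 0 ^ (3 / 2 : ℝ) := by
  rcases le_or_gt c 0 with hc | hc
  · rw [max_eq_right hc, Real.zero_rpow (by norm_num), mul_zero]
    rw [integral_congr_ae (g := fun _ => (0 : ℝ)), integral_zero]
    exact ae_of_all _ fun y => max_eq_right (by nlinarith [sq_nonneg y])
  · have hr : 0 ≤ Real.sqrt c := Real.sqrt_nonneg c
    have hsq : Real.sqrt c ^ 2 = c := Real.sq_sqrt hc.le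
    have hsupp : Function.support (fun y : ℝ => max (c - y ^ 2) 0) ⊆
        Ioc (-Real.sqrt c) (Real.sqrt c) := by
      intro y hy
      have h1 : y ^ 2 < c := by
        by_contra h
        exact hy (max_eq_right (by linarith))
      have := abs_lt.1 (abs_lt_sqrt_of_sq_lt h1)
      exact ⟨this.1, this.2.le⟩
    rw [← intervalIntegral.integral_eq_integral_of_support_subset hsupp]
    have h2 : ∫ y in -Real.sqrt c..Real.sqrt c, max (c - y ^ 2) 0 =
        ∫ y in -Real.sqrt c..Real.sqrt c, (c - y ^ 2) := by
      refine intervalIntegral.integral_congr fun y hy => ?_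
      rw [uIcc_of_le (by linarith)] at hy
      refine max_eq_left ?_
      rw [← hsq]
      nlinarith [hy.1, hy.2]
    have h3 : c ^ (3 / 2 : ℝ) = c * Real.sqrt c := by
      rw [show (3 / 2 : ℝ) = 1 + 1 / 2 by norm_num, Real.rpow_add hc, Real.rpow_one,
        Real.sqrt_eq_rpow]
    rw [h2, max_eq_left hc.le, h3, intervalIntegral.integral_sub (by simp)
      ((continuous_pow 2).intervalIntegrable _ _), integral_pow]
    simp only [intervalIntegral.integral_const, smul_eq_mul]
    push_cast
    linear_combination (-2 * Real.sqrt c / 3) * hsq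

/-- The sine part vanishes because the weight is even. -/
lemma integral_exp_mul_one_sub_sq (z : ℝ) :
    ∫ s in (-1 : ℝ)..1, Complex.exp (-(z * s : ℝ) * Complex.I) *
      (((1 - s ^ 2) ^ (3 / 2 : ℝ) : ℝ) : ℂ) = (besselInt z : ℂ) := by
  set F : ℝ → ℂ := fun s => Complex.exp (-(z * s : ℝ) * Complex.I) *
      (((1 - s ^ 2) ^ (3 / 2 : ℝ) : ℝ) : ℂ) with hF
  have hc : Continuous F := by
    have : Continuous fun s : ℝ => (1 - s ^ 2) ^ (3 / 2 : ℝ) :=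
      (Real.continuous_rpow_const (by norm_num)).comp (by fun_prop)
    fun_prop
  have hconj : (starRingEnd ℂ) (∫ s in (-1 : ℝ)..1, F s) = ∫ s in (-1 : ℝ)..1, F s := by
    have h1 := intervalIntegral.integral_comp_neg (a := -1) (b := 1) F
    rw [neg_neg] at h1
    rw [← intervalIntegral.intervalIntegral_conj, ← h1]
    congr 1
    ext s
    simp only [hF, map_mul, ← Complex.exp_conj, Complex.conj_ofReal, Complex.conj_I, map_neg,
      neg_sq]
    congr 2
    push_cast
    ring
  have hre : (∫ s in (-1 : ℝ)..1, F s).re = besselInt z := by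
    have h := Complex.reCLM.intervalIntegral_comp_comm (μ := volume)
      (hc.intervalIntegrable (-1) 1)
    simp only [Complex.reCLM_apply] at h
    rw [← h, besselInt]
    congr 1
    ext s
    rw [hF, Complex.re_mul_ofReal, ← Complex.ofReal_neg, Complex.exp_ofReal_mul_I_re, Real.cos_neg,
      mul_comm]
  rw [← hre]
  exact (Complex.conj_eq_iff_re.1 hconj).symm

lemma integral_exp_mul_max_rpow (ω : ℝ) {R : ℝ} (hR : 0 < R) :
    ∫ s : ℝ, Complex.exp (-(ω * s : ℝ) * Complex.I) *
      ((max (R - s ^ 2) 0 ^ (3 / 2 : ℝ) : ℝ) : ℂ) =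
      ((R ^ 2 * besselInt (ω * Real.sqrt R) : ℝ) : ℂ) := by
  set ρ := Real.sqrt R with hρ
  have hρ0 : 0 < ρ := Real.sqrt_pos.2 hR
  have hsq : ρ ^ 2 = R := Real.sq_sqrt hR.le
  have hsupp : Function.support (fun s : ℝ => Complex.exp (-(ω * s : ℝ) * Complex.I) *
      ((max (R - s ^ 2) 0 ^ (3 / 2 : ℝ) : ℝ) : ℂ)) ⊆ Ioc (-ρ) ρ := by
    intro y hy
    have h1 : y ^ 2 < R := by
      by_contra h
      apply hy
      simp only [max_eq_right (show R - y ^ 2 ≤ 0 by linarith)]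
      rw [Real.zero_rpow (by norm_num), Complex.ofReal_zero, mul_zero]
    have := abs_lt.1 (abs_lt_sqrt_of_sq_lt h1)
    exact ⟨this.1, this.2.le⟩
  rw [← intervalIntegral.integral_eq_integral_of_support_subset hsupp]
  have h1 := intervalIntegral.smul_integral_comp_mul_left (a := -1) (b := 1) ρ
    (f := fun s : ℝ => Complex.exp (-(ω * s : ℝ) * Complex.I) *
      ((max (R - s ^ 2) 0 ^ (3 / 2 : ℝ) : ℝ) : ℂ))
  rw [mul_neg, mul_one, Complex.real_smul] at h1
  rw [← h1, Complex.ofReal_mul, ← integral_exp_mul_one_sub_sq]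
  have h2 : ∀ u ∈ uIcc (-1 : ℝ) 1, Complex.exp (-(ω * (ρ * u) : ℝ) * Complex.I) *
      ((max (R - (ρ * u) ^ 2) 0 ^ (3 / 2 : ℝ) : ℝ) : ℂ) =
      ((ρ ^ 3 : ℝ) : ℂ) * (Complex.exp (-((ω * ρ) * u : ℝ) * Complex.I) *
        (((1 - u ^ 2) ^ (3 / 2 : ℝ) : ℝ) : ℂ)) := by
    intro u hu
    rw [uIcc_of_le (by norm_num)] at hu
    have h3 : 0 ≤ 1 - u ^ 2 := by nlinarith [hu.1, hu.2]
    have h4 : R - (ρ * u) ^ 2 = ρ ^ 2 * (1 - u ^ 2) := by rw [← hsq]; ring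
    have h5 : (ρ ^ 2) ^ (3 / 2 : ℝ) = ρ ^ 3 := by
      rw [← Real.rpow_natCast_mul hρ0.le, show ((2 : ℕ) : ℝ) * (3 / 2) = ((3 : ℕ) : ℝ) by norm_num,
        Real.rpow_natCast]
    rw [h4, max_eq_left (by positivity), Real.mul_rpow (by positivity) h3, h5,
      Complex.ofReal_mul (ρ ^ 3), mul_assoc ω ρ u]
    ring
  rw [intervalIntegral.integral_congr h2, intervalIntegral.integral_const_mul, ← hsq]
  push_cast
  ring

/-- The Fourier transform of `(R - |y|²)₊` on the plane, at a frequency along the first axis. -/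
lemma integral_plane_exp_mul_max (ω : ℝ) {R : ℝ} (hR : 0 < R) :
    ∫ y : Fin 2 → ℝ, Complex.exp (-(ω * y 0 : ℝ) * Complex.I) *
      ((max (R - (y 0 ^ 2 + y 1 ^ 2)) 0 : ℝ) : ℂ) =
      ((4 / 3 * R ^ 2 * besselInt (ω * Real.sqrt R) : ℝ) : ℂ) := by
  set G : ℝ × ℝ → ℂ := fun p => Complex.exp (-(ω * p.1 : ℝ) * Complex.I) *
      ((max (R - (p.1 ^ 2 + p.2 ^ 2)) 0 : ℝ) : ℂ) with hG
  have h1 : ∫ y : Fin 2 → ℝ, Complex.exp (-(ω * y 0 : ℝ) * Complex.I) *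
      ((max (R - (y 0 ^ 2 + y 1 ^ 2)) 0 : ℝ) : ℂ) = ∫ p : ℝ × ℝ, G p :=
    (volume_preserving_finTwoArrow ℝ).integral_comp
      MeasurableEquiv.finTwoArrow.measurableEmbedding G
  have hint : Integrable G (volume.prod volume) := by
    refine Continuous.integrable_of_hasCompactSupport (by fun_prop) ?_
    refine HasCompactSupport.of_support_subset_isCompact
      (isCompact_closedBall (0 : ℝ × ℝ) (Real.sqrt R)) fun p hp => ?_
    have h2 : p.1 ^ 2 + p.2 ^ 2 < R := by
      by_contra h
      apply hp
      simp only [hG, max_eq_right (show R - (p.1 ^ 2 + p.2 ^ 2) ≤ 0 by linarith)]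
      simp
    rw [mem_closedBall_zero_iff, Prod.norm_def, max_le_iff]
    exact ⟨(abs_lt_sqrt_of_sq_lt (by nlinarith [sq_nonneg p.2])).le,
      (abs_lt_sqrt_of_sq_lt (by nlinarith [sq_nonneg p.1])).le⟩
  have h3 : ∀ x : ℝ, ∫ y : ℝ, G (x, y) = ((4 / 3 : ℝ) : ℂ) *
      (Complex.exp (-(ω * x : ℝ) * Complex.I) * ((max (R - x ^ 2) 0 ^ (3 / 2 : ℝ) : ℝ) : ℂ)) := by
    intro x
    simp only [hG]
    rw [integral_const_mul, integral_complex_ofReal]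
    simp only [← sub_sub]
    rw [integral_max_sub_sq]
    push_cast
    ring
  rw [h1, Measure.volume_eq_prod, integral_prod _ hint]
  simp only [h3]
  rw [integral_const_mul, integral_exp_mul_max_rpow ω hR]
  push_cast
  ring

/-- The Fourier transform of `(R - q)₊` at `n`, for a quadratic form `q` on the plane and linear
coordinates `y = M x` in which `q = |y|²` and in which the frequency `2π n` lies along the first
axis. -/
lemma integral_wave_mul_max (M : Matrix (Fin 2) (Fin 2) ℝ) (hM : M.det ≠ 0) {q : (Fin 2 → ℝ) → ℝ}
    (hq : ∀ x, q x = (M.mulVec x 0) ^ 2 + (M.mulVec x 1) ^ 2) (n : Fin 2 → ℤ) (ω : ℝ)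
    (hn : ∀ x : Fin 2 → ℝ, 2 * Real.pi * ∑ i, n i * x i = ω * M.mulVec x 0)
    {R : ℝ} (hR : 0 < R) :
    ∫ x, wave n x * ((max (R - q x) 0 : ℝ) : ℂ) =
      ((|M.det|⁻¹ * (4 / 3 * R ^ 2 * besselInt (ω * Real.sqrt R)) : ℝ) : ℂ) := by
  set G : (Fin 2 → ℝ) → ℂ := fun y => Complex.exp (-(ω * y 0 : ℝ) * Complex.I) *
      ((max (R - (y 0 ^ 2 + y 1 ^ 2)) 0 : ℝ) : ℂ) with hG
  have hGc : Continuous G := by fun_prop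
  have h1 : ∀ x, wave n x * ((max (R - q x) 0 : ℝ) : ℂ) = G (Matrix.toLin' M x) := by
    intro x
    rw [wave, hn, hq, hG, Matrix.toLin'_apply]
  have hmeas : Measurable (Matrix.toLin' M) :=
    (LinearMap.continuous_of_finiteDimensional (Matrix.toLin' M)).measurable
  simp only [h1]
  rw [← integral_map hmeas.aemeasurable hGc.aestronglyMeasurable,
    Real.map_matrix_volume_pi_eq_smul_volume_pi hM, integral_smul_measure,
    integral_plane_exp_mul_max ω hR, ENNReal.toReal_ofReal (abs_nonneg _), abs_inv,
    Complex.real_smul, ← Complex.ofReal_mul]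

end Transform

/-! ### The quadratic forms -/

section Forms

variable (a : Fin 2 → ℝ) (v : OrthonormalBasis (Fin 2) ℝ Plane)

lemma inner_sq_add_inner_sq (x : Plane) :
    (inner ℝ x (v 0)) ^ 2 + (inner ℝ x (v 1)) ^ 2 = ‖x‖ ^ 2 := by
  have := v.sum_sq_norm_inner_left x
  simpa [Fin.sum_univ_two, sq_abs] using this

lemma invForm_eq_Q (x : Plane) : invForm a v x = Q (fun i => (a i)⁻¹) v x := by
  simp only [invForm, Q, div_eq_inv_mul]

variable {a}

lemma norm_sq_le_mul_Q (ha : ∀ i, 0 < a i) (x : Plane) :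
    ‖x‖ ^ 2 ≤ ((a 0 ^ 2)⁻¹ + (a 1 ^ 2)⁻¹) * Q a v x := by
  have h0 := ha 0
  have h1 := ha 1
  rw [← inner_sq_add_inner_sq v x, Q]
  set s := inner ℝ x (v 0)
  set t := inner ℝ x (v 1)
  have e : ((a 0 ^ 2)⁻¹ + (a 1 ^ 2)⁻¹) * ((a 0 * s) ^ 2 + (a 1 * t) ^ 2) =
      s ^ 2 + t ^ 2 + (a 0 ^ 2)⁻¹ * (a 1 * t) ^ 2 + (a 1 ^ 2)⁻¹ * (a 0 * s) ^ 2 := by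
    field_simp
    ring
  rw [e]
  have : 0 ≤ (a 0 ^ 2)⁻¹ * (a 1 * t) ^ 2 := by positivity
  have : 0 ≤ (a 1 ^ 2)⁻¹ * (a 0 * s) ^ 2 := by positivity
  linarith

lemma Q_nonneg (a : Fin 2 → ℝ) (x : Plane) : 0 ≤ Q a v x := by
  unfold Q; positivity

lemma Q_pos (ha : ∀ i, 0 < a i) {x : Plane} (hx : x ≠ 0) : 0 < Q a v x := by
  have h := norm_sq_le_mul_Q v ha x
  have h1 : 0 < ‖x‖ ^ 2 := by positivity
  by_contra hQ
  have h2 : Q a v x = 0 := le_antisymm (not_lt.1 hQ) (Q_nonneg v a x)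
  rw [h2, mul_zero] at h
  linarith

lemma inner_apply_eq (x : Fin 2 → ℝ) (w : Plane) :
    inner ℝ (WithLp.toLp 2 x : Plane) w = x 0 * w 0 + x 1 * w 1 := by
  simp [PiLp.inner_apply, Fin.sum_univ_two, mul_comm]

lemma continuous_Q (a : Fin 2 → ℝ) : Continuous fun x : Fin 2 → ℝ => Q a v (WithLp.toLp 2 x) := by
  simp only [Q, inner_apply_eq]
  fun_prop

lemma det_orthonormalBasis_sq : (v 0 0 * v 1 1 - v 0 1 * v 1 0) ^ 2 = 1 := by
  have h : ∀ i j, v i 0 * v j 0 + v i 1 * v j 1 = if i = j then 1 else 0 := by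
    intro i j
    rw [← orthonormal_iff_ite.1 v.orthonormal i j, PiLp.inner_apply, Fin.sum_univ_two]
    simp [mul_comm]
  have h00 := h 0 0
  have h01 := h 0 1
  have h11 := h 1 1
  simp only [if_true, Fin.isValue, zero_ne_one, if_false] at h00 h01 h11
  linear_combination (v 1 0 ^ 2 + v 1 1 ^ 2) * h00 + h11 -
    (v 0 0 * v 1 0 + v 0 1 * v 1 1) * h01

/-- Polar coordinates, valid at the origin too. -/
lemma exists_polar (p q : ℝ) : ∃ c s : ℝ, c ^ 2 + s ^ 2 = 1 ∧
    p = Real.sqrt (p ^ 2 + q ^ 2) * c ∧ q = Real.sqrt (p ^ 2 + q ^ 2) * s := by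
  rcases eq_or_ne (p ^ 2 + q ^ 2) 0 with h | h
  · refine ⟨1, 0, by norm_num, ?_, ?_⟩ <;> nlinarith [sq_nonneg p, sq_nonneg q,
      Real.sqrt_eq_zero'.2 h.le]
  · have h0 : 0 < p ^ 2 + q ^ 2 := lt_of_le_of_ne (by positivity) h.symm
    have h1 := Real.sq_sqrt h0.le
    have h2 := (Real.sqrt_pos.2 h0).ne'
    refine ⟨p / Real.sqrt (p ^ 2 + q ^ 2), q / Real.sqrt (p ^ 2 + q ^ 2), ?_, ?_, ?_⟩
    · rw [div_pow, div_pow, h1, ← add_div, div_self h]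
    · field_simp
    · field_simp

/-- The Fourier transform of `(R - (2π)² invForm)₊` at an integer point. The linear coordinates
that diagonalize the form are rotated so that the frequency lies along the first axis. -/
lemma integral_wave_mul_max_invForm (ha : ∀ i, 0 < a i) (n : Fin 2 → ℤ) {R : ℝ} (hR : 0 < R) :
    ∫ x : Fin 2 → ℝ, wave n x *
        ((max (R - (2 * Real.pi) ^ 2 * invForm a v (WithLp.toLp 2 x)) 0 : ℝ) : ℂ) =
      ((a 0 * a 1 / (3 * Real.pi ^ 2) * R ^ 2 *
        besselInt (Real.sqrt (Q a v (intVec n)) * Real.sqrt R) : ℝ) : ℂ) := by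
  have h0 := ha 0
  have h1 := ha 1
  obtain ⟨c, s, hcs, hc, hs⟩ := exists_polar (a 0 * inner ℝ (intVec n) (v 0))
    (a 1 * inner ℝ (intVec n) (v 1))
  change _ = Real.sqrt (Q a v (intVec n)) * _ at hc
  change _ = Real.sqrt (Q a v (intVec n)) * _ at hs
  -- `(c, s)` is the direction of the frequency in the coordinates in which the form is `|y|²`.
  set M : Matrix (Fin 2) (Fin 2) ℝ := Matrix.of ![
    fun j => 2 * Real.pi * (c * (v 0 j / a 0) + s * (v 1 j / a 1)),
    fun j => 2 * Real.pi * (-s * (v 0 j / a 0) + c * (v 1 j / a 1))] with hMdef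
  have hM0 : ∀ x : Fin 2 → ℝ, M.mulVec x 0 = 2 * Real.pi *
      (c * (inner ℝ (WithLp.toLp 2 x) (v 0) / a 0) +
        s * (inner ℝ (WithLp.toLp 2 x) (v 1) / a 1)) := by
    intro x
    rw [inner_apply_eq, inner_apply_eq]
    simp only [hMdef, Matrix.mulVec, dotProduct, Fin.sum_univ_two, Matrix.of_apply,
      Matrix.cons_val_zero]
    ring
  have hM1 : ∀ x : Fin 2 → ℝ, M.mulVec x 1 = 2 * Real.pi *
      (-s * (inner ℝ (WithLp.toLp 2 x) (v 0) / a 0) +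
        c * (inner ℝ (WithLp.toLp 2 x) (v 1) / a 1)) := by
    intro x
    rw [inner_apply_eq, inner_apply_eq]
    simp only [hMdef, Matrix.mulVec, dotProduct, Fin.sum_univ_two, Matrix.of_apply,
      Matrix.cons_val_one, Matrix.cons_val_fin_one]
    ring
  have hdet : M.det = (2 * Real.pi) ^ 2 / (a 0 * a 1) * (v 0 0 * v 1 1 - v 0 1 * v 1 0) := by
    rw [Matrix.det_fin_two]
    simp only [hMdef, Matrix.of_apply, Matrix.cons_val_zero, Matrix.cons_val_one,
      Matrix.cons_val_fin_one]
    field_simp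
    linear_combination a 0 * a 1 * (v 0 0 * v 1 1 - v 0 1 * v 1 0) * hcs
  have habs : |M.det| = (2 * Real.pi) ^ 2 / (a 0 * a 1) := by
    have h2 : |v 0 0 * v 1 1 - v 0 1 * v 1 0| = 1 :=
      (pow_eq_one_iff_of_nonneg (abs_nonneg _) two_ne_zero).1 (by rw [sq_abs, det_orthonormalBasis_sq])
    rw [hdet, abs_mul, h2, mul_one, abs_of_pos (by positivity)]
  have hMne : M.det ≠ 0 := by
    rw [← abs_pos, habs]
    positivity
  have key := integral_wave_mul_max M hMne
    (q := fun x => (2 * Real.pi) ^ 2 * invForm a v (WithLp.toLp 2 x)) ?_ n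
    (Real.sqrt (Q a v (intVec n))) ?_ hR
  · rw [key, habs]
    congr 1
    field_simp
    ring
  · intro x
    rw [hM0, hM1, invForm]
    linear_combination -(2 * Real.pi) ^ 2 * ((inner ℝ (WithLp.toLp 2 x) (v 0) / a 0) ^ 2 +
      (inner ℝ (WithLp.toLp 2 x) (v 1) / a 1) ^ 2) * hcs
  · intro x
    have h2 : ∑ i, n i * x i = inner ℝ (intVec n) (v 0) * inner ℝ (WithLp.toLp 2 x) (v 0) +
        inner ℝ (intVec n) (v 1) * inner ℝ (WithLp.toLp 2 x) (v 1) := by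
      have := v.sum_inner_mul_inner (intVec n) (WithLp.toLp 2 x)
      rw [Fin.sum_univ_two, real_inner_comm (WithLp.toLp 2 x) (v 0),
        real_inner_comm (WithLp.toLp 2 x) (v 1)] at this
      rw [this, intVec, PiLp.inner_apply]
      simp [mul_comm]
    rw [h2, hM0]
    have e : Real.sqrt (Q a v (intVec n)) * (2 * Real.pi *
        (c * (inner ℝ (WithLp.toLp 2 x) (v 0) / a 0) +
          s * (inner ℝ (WithLp.toLp 2 x) (v 1) / a 1))) = 2 * Real.pi *
        ((Real.sqrt (Q a v (intVec n)) * c) * (inner ℝ (WithLp.toLp 2 x) (v 0) / a 0) +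
          (Real.sqrt (Q a v (intVec n)) * s) * (inner ℝ (WithLp.toLp 2 x) (v 1) / a 1)) := by
      ring
    rw [e, ← hc, ← hs]
    field_simp

end Forms

/-! ### Summation over the lattice -/

section Lattice

open MeasureTheory Set Filter

variable {a : Fin 2 → ℝ} (v : OrthonormalBasis (Fin 2) ℝ Plane)

lemma norm_int_le_norm_intVec (n : Fin 2 → ℤ) : ‖n‖ ≤ ‖intVec n‖ := by
  rw [pi_norm_le_iff_of_nonneg (norm_nonneg _)]
  intro i
  have := PiLp.norm_apply_le (intVec n) i
  simpa [intVec, Int.norm_eq_abs] using this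

lemma intVec_ne_zero {n : Fin 2 → ℤ} (hn : n ≠ 0) : intVec n ≠ 0 := by
  intro h
  have := norm_int_le_norm_intVec n
  rw [h, norm_zero] at this
  exact hn (norm_le_zero_iff.1 this)

lemma Q_intVec_pos (ha : ∀ i, 0 < a i) (n : {n : Fin 2 → ℤ // n ≠ 0}) :
    0 < Q a v (intVec n) :=
  Q_pos v ha (intVec_ne_zero n.2)

lemma norm_sq_int_le_mul_Q (ha : ∀ i, 0 < a i) (n : Fin 2 → ℤ) :
    ‖n‖ ^ 2 ≤ ((a 0 ^ 2)⁻¹ + (a 1 ^ 2)⁻¹) * Q a v (intVec n) :=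
  (pow_le_pow_left₀ (norm_nonneg _) (norm_int_le_norm_intVec n) 2).trans (norm_sq_le_mul_Q v ha _)

/-- Comparison with the Eisenstein series `∑ ‖n‖^{-2s}`, which converges for `2s > 2`. -/
lemma summable_Q_rpow (ha : ∀ i, 0 < a i) {s : ℝ} (hs : 1 < s) :
    Summable fun n : {n : Fin 2 → ℤ // n ≠ 0} => Q a v (intVec n) ^ (-s) := by
  have h0 := ha 0
  have h1 := ha 1
  set K := (a 0 ^ 2)⁻¹ + (a 1 ^ 2)⁻¹ with hK
  have hK0 : 0 < K := by positivity
  have hsum : Summable fun n : {n : Fin 2 → ℤ // n ≠ 0} =>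
      K ^ s * ‖(n : Fin 2 → ℤ)‖ ^ (-(2 * s)) :=
    ((EisensteinSeries.summable_one_div_norm_rpow (k := 2 * s) (by linarith)).subtype _).mul_left _
  refine Summable.of_nonneg_of_le (fun n => Real.rpow_nonneg (Q_nonneg v a _) _) (fun n => ?_) hsum
  have hQ := Q_intVec_pos v ha n
  have hn : 0 < ‖(n : Fin 2 → ℤ)‖ := norm_pos_iff.2 n.2
  have h2 : ‖(n : Fin 2 → ℤ)‖ ^ (-(2 * s)) = (‖(n : Fin 2 → ℤ)‖ ^ 2) ^ (-s) := by
    rw [← Real.rpow_natCast_mul hn.le]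
    push_cast
    ring_nf
  have h3 : K ^ s = (K⁻¹) ^ (-s) := by
    rw [Real.rpow_neg (by positivity), Real.inv_rpow hK0.le, inv_inv]
  rw [h2, h3, ← Real.mul_rpow (by positivity) (by positivity)]
  refine Real.rpow_le_rpow_of_nonpos (by positivity) ?_ (by linarith)
  rw [inv_mul_le_iff₀ hK0]
  exact norm_sq_int_le_mul_Q v ha n

lemma invForm_nonneg (x : Plane) : 0 ≤ invForm a v x := by
  unfold invForm; positivity

lemma norm_sq_le_mul_invForm (ha : ∀ i, 0 < a i) (x : Plane) :
    ‖x‖ ^ 2 ≤ (a 0 ^ 2 + a 1 ^ 2) * invForm a v x := by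
  have := norm_sq_le_mul_Q v (fun i => inv_pos.2 (ha i)) x
  rw [invForm_eq_Q]
  simpa using this

lemma finite_lattice_ellipse (ha : ∀ i, 0 < a i) (t : ℝ) :
    {n : Fin 2 → ℤ | intVec n ∈ ellipse a v t}.Finite := by
  refine ((isCompact_closedBall (0 : Fin 2 → ℤ)
    (Real.sqrt ((a 0 ^ 2 + a 1 ^ 2) * t))).finite_of_discrete).subset fun n hn => ?_
  rw [mem_closedBall_zero_iff]
  refine Real.le_sqrt_of_sq_le ?_
  have h1 : (2 * Real.pi) ^ 2 * invForm a v (intVec n) ≤ t := hn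
  have h2 : invForm a v (intVec n) ≤ (2 * Real.pi) ^ 2 * invForm a v (intVec n) :=
    le_mul_of_one_le_left (invForm_nonneg v _) (by nlinarith [Real.pi_gt_three])
  calc ‖n‖ ^ 2 ≤ ‖intVec n‖ ^ 2 := by gcongr; exact norm_int_le_norm_intVec n
    _ ≤ (a 0 ^ 2 + a 1 ^ 2) * invForm a v (intVec n) := norm_sq_le_mul_invForm v ha _
    _ ≤ _ := by gcongr; linarith

lemma monotone_count (ha : ∀ i, 0 < a i) : Monotone fun t => (count a v t : ℝ) := by
  intro s t hst
  refine Nat.cast_le.2 (Set.ncard_le_ncard (fun n hn => ?_) (finite_lattice_ellipse v ha t))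
  exact le_trans (show (2 * Real.pi) ^ 2 * invForm a v (intVec n) ≤ s from hn) hst

lemma monotone_step (l : ℝ) : Monotone fun t : ℝ => if l ≤ t then (1 : ℝ) else 0 := by
  intro s t hst
  dsimp only
  split_ifs with h1 h2
  · rfl
  · exact absurd (h1.trans hst) h2
  · exact zero_le_one
  · rfl

lemma integral_step {l R : ℝ} (hl : 0 ≤ l) (hlR : l ≤ R) :
    ∫ t in (0 : ℝ)..R, (if l ≤ t then (1 : ℝ) else 0) = R - l := by
  have hmono := monotone_step l
  rw [← intervalIntegral.integral_add_adjacent_intervals (b := l) hmono.intervalIntegrable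
    hmono.intervalIntegrable]
  have h1 : ∫ t in (0 : ℝ)..l, (if l ≤ t then (1 : ℝ) else 0) = ∫ t in (0 : ℝ)..l, (0 : ℝ) := by
    refine intervalIntegral.integral_congr_ae ?_
    filter_upwards [Measure.ae_ne volume l] with t ht h
    rw [uIoc_of_le hl] at h
    exact if_neg (not_le.2 (lt_of_le_of_ne h.2 ht))
  have h2 : ∫ t in l..R, (if l ≤ t then (1 : ℝ) else 0) = ∫ t in l..R, (1 : ℝ) := by
    refine intervalIntegral.integral_congr fun t ht => ?_
    rw [uIcc_of_le hlR] at ht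
    exact if_pos ht.1
  rw [h1, h2]
  simp

/-- The integral of the counting function is the sum of `(R - λ)₊` over the eigenvalues. -/
lemma integral_count (ha : ∀ i, 0 < a i) {R : ℝ} (hR : 0 < R) :
    ∫ t in (0 : ℝ)..R, (count a v t : ℝ) =
      ∑' n : Fin 2 → ℤ, max (R - (2 * Real.pi) ^ 2 * invForm a v (intVec n)) 0 := by
  set S := (finite_lattice_ellipse v ha R).toFinset with hS
  set l : (Fin 2 → ℤ) → ℝ := fun n => (2 * Real.pi) ^ 2 * invForm a v (intVec n) with hl
  have hmem : ∀ n, n ∈ S ↔ l n ≤ R := by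
    intro n
    rw [hS, Set.Finite.mem_toFinset]
    rfl
  have hl0 : ∀ n, 0 ≤ l n := fun n => mul_nonneg (by positivity) (invForm_nonneg v _)
  have h1 : ∀ t ∈ uIcc 0 R, (count a v t : ℝ) = ∑ n ∈ S, if l n ≤ t then (1 : ℝ) else 0 := by
    intro t ht
    rw [uIcc_of_le hR.le] at ht
    have h2 : {n : Fin 2 → ℤ | intVec n ∈ ellipse a v t} =
        ((S.filter fun n => l n ≤ t : Finset (Fin 2 → ℤ)) : Set (Fin 2 → ℤ)) := by
      ext n
      rw [Finset.mem_coe, Finset.mem_filter, hmem]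
      exact ⟨fun h => ⟨le_trans (show l n ≤ t from h) ht.2, h⟩, fun h => h.2⟩
    rw [count, h2, Set.ncard_coe_finset, Finset.sum_boole]
  rw [intervalIntegral.integral_congr h1,
    intervalIntegral.integral_finsetSum fun n _ => (monotone_step (l n)).intervalIntegrable,
    tsum_eq_sum (s := S)]
  · refine Finset.sum_congr rfl fun n hn => ?_
    have := (hmem n).1 hn
    rw [integral_step (hl0 n) this, max_eq_left (by linarith)]
  · intro n hn
    rw [hmem, not_le] at hn
    exact max_eq_right (by linarith)

/-- The cut-off paraboloid `(R - (2π)² invForm)₊`, to which Poisson summation is applied. -/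
def paraboloid (a : Fin 2 → ℝ) (v : OrthonormalBasis (Fin 2) ℝ Plane) (R : ℝ)
    (x : Fin 2 → ℝ) : ℂ :=
  ((max (R - (2 * Real.pi) ^ 2 * invForm a v (WithLp.toLp 2 x)) 0 : ℝ) : ℂ)

lemma continuous_paraboloid (R : ℝ) : Continuous (paraboloid a v R) := by
  have := continuous_Q v fun i => (a i)⁻¹
  simp only [← invForm_eq_Q] at this
  unfold paraboloid
  fun_prop

lemma hasCompactSupport_paraboloid (ha : ∀ i, 0 < a i) (R : ℝ) :
    HasCompactSupport (paraboloid a v R) := by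
  refine HasCompactSupport.of_support_subset_isCompact (isCompact_closedBall (0 : Fin 2 → ℝ)
    (Real.sqrt ((a 0 ^ 2 + a 1 ^ 2) * R))) fun x hx => ?_
  rw [mem_closedBall_zero_iff]
  refine Real.le_sqrt_of_sq_le ?_
  have h1 : (2 * Real.pi) ^ 2 * invForm a v (WithLp.toLp 2 x) < R := by
    by_contra h
    apply hx
    rw [paraboloid, max_eq_right (by linarith), Complex.ofReal_zero]
  have h2 : invForm a v (WithLp.toLp 2 x) ≤ (2 * Real.pi) ^ 2 * invForm a v (WithLp.toLp 2 x) :=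
    le_mul_of_one_le_left (invForm_nonneg v _) (by nlinarith [Real.pi_gt_three])
  have h3 : ‖x‖ ≤ ‖(WithLp.toLp 2 x : Plane)‖ := by
    rw [pi_norm_le_iff_of_nonneg (norm_nonneg _)]
    intro i
    exact PiLp.norm_apply_le (WithLp.toLp 2 x : Plane) i
  calc ‖x‖ ^ 2 ≤ ‖(WithLp.toLp 2 x : Plane)‖ ^ 2 := by gcongr
    _ ≤ (a 0 ^ 2 + a 1 ^ 2) * invForm a v (WithLp.toLp 2 x) := norm_sq_le_mul_invForm v ha _
    _ ≤ _ := by gcongr; linarith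

lemma sqrt_mul_sqrt_rpow {q R : ℝ} (hq : 0 ≤ q) (hR : 0 ≤ R) (s : ℝ) :
    (Real.sqrt q * Real.sqrt R) ^ s = q ^ (s / 2) * R ^ (s / 2) := by
  rw [Real.mul_rpow (Real.sqrt_nonneg _) (Real.sqrt_nonneg _), Real.sqrt_eq_rpow,
    Real.sqrt_eq_rpow, ← Real.rpow_mul hq, ← Real.rpow_mul hR]
  ring_nf

/-- The bound `O(z^{-5/2} + z^{-9/2})` for `besselInt` holds for all `z > 0`, and `5/4 > 1`. -/
lemma summable_besselInt (ha : ∀ i, 0 < a i) {R : ℝ} (hR : 0 < R) :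
    Summable fun n : {n : Fin 2 → ℤ // n ≠ 0} =>
      besselInt (Real.sqrt (Q a v (intVec n)) * Real.sqrt R) := by
  obtain ⟨α, -, hα⟩ := exists_expansion_besselInt
  obtain ⟨C, hC0, hC⟩ := hα 0
  have hs : Summable fun n : {n : Fin 2 → ℤ // n ≠ 0} =>
      C * (Q a v (intVec n) ^ (-(5 / 4 : ℝ)) * R ^ (-(5 / 4 : ℝ)) +
        Q a v (intVec n) ^ (-(9 / 4 : ℝ)) * R ^ (-(9 / 4 : ℝ))) :=
    (((summable_Q_rpow v ha (by norm_num)).mul_right _).add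
      ((summable_Q_rpow v ha (by norm_num)).mul_right _)).mul_left C
  refine Summable.of_norm_bounded hs fun n => ?_
  have hQ := Q_intVec_pos v ha n
  have := hC (Real.sqrt (Q a v (intVec n)) * Real.sqrt R) (by positivity)
  rw [Finset.sum_range_zero, sub_zero, sqrt_mul_sqrt_rpow hQ.le hR.le,
    sqrt_mul_sqrt_rpow hQ.le hR.le] at this
  rw [Real.norm_eq_abs]
  convert this using 6 <;> push_cast <;> ring

/-- Hardy's identity in integrated form: the mean of the discrepancy as an absolutely convergent
series over the nonzero integer points. The point `0` contributes the area term. -/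
lemma averagedError_eq (ha : ∀ i, 0 < a i) {R : ℝ} (hR : 0 < R) :
    averagedError a v R = a 0 * a 1 / (3 * Real.pi ^ 2) * R *
      ∑' n : {n : Fin 2 → ℤ // n ≠ 0},
        besselInt (Real.sqrt (Q a v (intVec n)) * Real.sqrt R) := by
  set b : (Fin 2 → ℤ) → ℝ := fun n =>
    besselInt (Real.sqrt (Q a v (intVec n)) * Real.sqrt R) with hb
  set K := a 0 * a 1 / (3 * Real.pi ^ 2) * R ^ 2 with hK
  have hinj : Function.Injective (Subtype.val : {n : Fin 2 → ℤ // n ≠ 0} → Fin 2 → ℤ) :=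
    Subtype.val_injective
  -- the series without its term at `0`, extended by zero
  set b' : (Fin 2 → ℤ) → ℝ := fun n => if n = 0 then 0 else b n with hb'
  have hbb' : (b' ∘ Subtype.val : {n : Fin 2 → ℤ // n ≠ 0} → ℝ) = fun n => b n.1 := by
    ext n
    simp [hb', n.2]
  have hout : ∀ n ∉ range (Subtype.val : {n : Fin 2 → ℤ // n ≠ 0} → Fin 2 → ℤ), b' n = 0 := by
    intro n hn
    by_cases h : n = 0
    · simp [hb', h]
    · exact absurd ⟨⟨n, h⟩, rfl⟩ hn
  have hsum' : Summable b' := by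
    rw [← hinj.summable_iff hout, hbb']
    exact summable_besselInt v ha hR
  have hsum : Summable b := by
    refine (summable_congr_cofinite ?_).1 hsum'
    filter_upwards [(Set.finite_singleton (0 : Fin 2 → ℤ)).compl_mem_cofinite] with n hn
    exact if_neg hn
  have htsum : ∑' n, b n = b 0 + ∑' n : {n : Fin 2 → ℤ // n ≠ 0}, b n := by
    rw [hsum.tsum_eq_add_tsum_ite 0, ← hinj.tsum_eq (f := b')]
    · congr 1
      exact tsum_congr fun n => congrFun hbb' n
    · intro n hn
      by_contra h
      exact hn (hout n h)
  have hFT : ∀ n : Fin 2 → ℤ, ∫ x, wave n x * paraboloid a v R x = ((K * b n : ℝ) : ℂ) :=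
    fun n => integral_wave_mul_max_invForm v ha n hR
  have hpoisson := hasSum_integral_wave_mul (continuous_paraboloid v R)
    (hasCompactSupport_paraboloid v ha R) (by
      simp only [hFT]
      exact (Complex.hasSum_ofReal.2 (hsum.mul_left K).hasSum).summable)
  simp only [hFT] at hpoisson
  have h2 : ∑' m : Fin 2 → ℤ, paraboloid a v R (fun i => (m i : ℝ)) =
      ((∑' n : Fin 2 → ℤ, max (R - (2 * Real.pi) ^ 2 * invForm a v (intVec n)) 0 : ℝ) : ℂ) := by
    rw [Complex.ofReal_tsum]
    rfl
  rw [h2, Complex.hasSum_ofReal] at hpoisson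
  have h3 := hpoisson.tsum_eq
  rw [tsum_mul_left, htsum, ← integral_count v ha hR] at h3
  have hb0 : b 0 = 3 * Real.pi / 8 := by
    have : intVec 0 = 0 := by
      ext i
      simp [intVec]
    simp [hb, this, Q, besselInt_zero]
  have h4 : ∫ t in (0 : ℝ)..R, discrepancy a v t =
      (∫ t in (0 : ℝ)..R, (count a v t : ℝ)) - a 0 * a 1 / (4 * Real.pi) * (R ^ 2 / 2) := by
    have h5 : ∀ t, discrepancy a v t = (count a v t : ℝ) - a 0 * a 1 / (4 * Real.pi) * t := by
      intro t
      rw [discrepancy]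
      ring
    simp only [h5]
    rw [intervalIntegral.integral_sub (monotone_count v ha).intervalIntegrable
      (Continuous.intervalIntegrable (by fun_prop) _ _),
      intervalIntegral.integral_const_mul, integral_id]
    ring
  rw [averagedError, h4, ← h3, hb0, hK]
  field_simp
  ring

end Lattice

/-! ### Almost periodic series -/

section AlmostPeriodic

open MeasureTheory Set Filter

/-- The complex trigonometric polynomials with real frequencies. -/
def trigPolys : Submodule ℂ (ℝ → ℂ) :=
  Submodule.span ℂ (range fun (ω : ℝ) (x : ℝ) => Complex.exp (Complex.I * ω * x))

lemma exp_mem_trigPolys (ω : ℝ) :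
    (fun x : ℝ => Complex.exp (Complex.I * ω * x)) ∈ trigPolys :=
  Submodule.subset_span ⟨ω, rfl⟩

lemma uniformlyAlmostPeriodic_of_trigPolys {f : ℝ → ℝ}
    (h : ∀ ε : ℝ, 0 < ε → ∃ p ∈ trigPolys, ∀ x : ℝ, ‖(f x : ℂ) - p x‖ ≤ ε) :
    UniformlyAlmostPeriodic f := by
  intro ε hε
  obtain ⟨p, hp, hfp⟩ := h ε hε
  obtain ⟨c, hc⟩ := Finsupp.mem_span_range_iff_exists_finsupp.1 hp
  refine ⟨c.support, c, fun x => ?_⟩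
  have : p x = ∑ ω ∈ c.support, c ω * Complex.exp (Complex.I * (ω : ℂ) * (x : ℂ)) := by
    rw [← hc, Finsupp.sum, Finset.sum_apply]
    rfl
  rw [← this]
  exact hfp x

lemma im_exp_mul_mem_trigPolys (ω : ℝ) (c : ℂ) :
    (fun x : ℝ => (((Complex.exp (Complex.I * (ω * x : ℝ)) * c).im : ℝ) : ℂ)) ∈ trigPolys := by
  have h : (fun x : ℝ => (((Complex.exp (Complex.I * (ω * x : ℝ)) * c).im : ℝ) : ℂ)) =
      (c / (2 * Complex.I)) • (fun x : ℝ => Complex.exp (Complex.I * ω * x)) -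
      ((starRingEnd ℂ) c / (2 * Complex.I)) •
        (fun x : ℝ => Complex.exp (Complex.I * (-ω : ℝ) * x)) := by
    ext x
    simp only [Pi.sub_apply, Pi.smul_apply, smul_eq_mul]
    rw [Complex.im_eq_sub_conj, map_mul, ← Complex.exp_conj, map_mul, Complex.conj_I,
      Complex.conj_ofReal]
    have e1 : Complex.I * ((ω * x : ℝ) : ℂ) = Complex.I * ω * x := by push_cast; ring
    have e2 : -Complex.I * ((ω * x : ℝ) : ℂ) = Complex.I * (-ω : ℝ) * x := by push_cast; ring
    rw [e1, e2]
    ring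
  rw [h]
  exact Submodule.sub_mem _ (Submodule.smul_mem _ _ (exp_mem_trigPolys ω))
    (Submodule.smul_mem _ _ (exp_mem_trigPolys (-ω)))

variable {ι : Type*} {ω : ι → ℝ} {c : ι → ℂ}

lemma abs_im_exp_mul_le (t : ℝ) (c : ℂ) : |(Complex.exp (Complex.I * t) * c).im| ≤ ‖c‖ := by
  refine (Complex.abs_im_le_norm _).trans ?_
  rw [norm_mul, mul_comm Complex.I, Complex.norm_exp_ofReal_mul_I, one_mul]

lemma summable_im_exp_mul (hc : Summable fun i => ‖c i‖) (x : ℝ) :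
    Summable fun i => (Complex.exp (Complex.I * (ω i * x : ℝ)) * c i).im :=
  Summable.of_norm_bounded hc fun _ => abs_im_exp_mul_le _ _

/-- An absolutely convergent trigonometric series is uniformly almost periodic. -/
lemma uniformlyAlmostPeriodic_tsum (hc : Summable fun i => ‖c i‖) :
    UniformlyAlmostPeriodic fun x =>
      ∑' i, (Complex.exp (Complex.I * (ω i * x : ℝ)) * c i).im := by
  refine uniformlyAlmostPeriodic_of_trigPolys fun ε hε => ?_
  obtain ⟨s, hs⟩ :=
    ((tendsto_order.1 (tendsto_tsum_compl_atTop_zero fun i => ‖c i‖)).2 ε hε).exists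
  refine ⟨∑ i ∈ s, fun x : ℝ => (((Complex.exp (Complex.I * (ω i * x : ℝ)) * c i).im : ℝ) : ℂ),
    Submodule.sum_mem _ fun i _ => im_exp_mul_mem_trigPolys _ _, fun x => ?_⟩
  have hsum := summable_im_exp_mul (ω := ω) hc x
  rw [Finset.sum_apply, ← Complex.ofReal_sum, ← Complex.ofReal_sub, Complex.norm_real,
    ← hsum.sum_add_tsum_compl (s := s), add_sub_cancel_left]
  have hc' : Summable fun i : ((s : Set ι)ᶜ : Set ι) => ‖c i‖ := hc.subtype _
  exact (tsum_of_norm_bounded hc'.hasSum fun i => abs_im_exp_mul_le _ _).trans hs.le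

lemma abs_integral_im_exp_mul_le {ω : ℝ} (hω : ω ≠ 0) (c : ℂ) (T : ℝ) :
    |∫ x in (0 : ℝ)..T, (Complex.exp (Complex.I * (ω * x : ℝ)) * c).im| ≤ 2 * ‖c‖ / |ω| := by
  have hω' : Complex.I * ω ≠ 0 := mul_ne_zero Complex.I_ne_zero (Complex.ofReal_ne_zero.2 hω)
  have h1 := Complex.imCLM.intervalIntegral_comp_comm (μ := volume) (a := 0) (b := T)
    (f := fun x : ℝ => Complex.exp (Complex.I * (ω * x : ℝ)) * c)
    (Continuous.intervalIntegrable (by fun_prop) _ _)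
  simp only [Complex.imCLM_apply] at h1
  have h2 : ∫ x in (0 : ℝ)..T, Complex.exp (Complex.I * (ω * x : ℝ)) * c =
      (Complex.exp ((ω * T : ℝ) * Complex.I) - 1) / (Complex.I * ω) * c := by
    have h3 : ∀ x : ℝ, Complex.I * ((ω * x : ℝ) : ℂ) = Complex.I * ω * x := by
      intro x; push_cast; ring
    simp only [h3]
    rw [intervalIntegral.integral_mul_const, integral_exp_mul_complex hω', ← h3, mul_comm Complex.I]
    simp
  rw [h1, h2]
  refine (Complex.abs_im_le_norm _).trans ?_
  rw [norm_mul, norm_div, norm_mul, Complex.norm_I, one_mul, Complex.norm_real, Real.norm_eq_abs,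
    div_mul_eq_mul_div]
  gcongr
  refine (norm_sub_le _ _).trans ?_
  rw [Complex.norm_exp_ofReal_mul_I, norm_one]
  norm_num

/-- An absolutely convergent trigonometric series without the frequency `0` has mean zero. -/
lemma meanValueZero_tsum [Countable ι] (hω : ∀ i, ω i ≠ 0) (hc : Summable fun i => ‖c i‖) :
    MeanValueZero fun x => ∑' i, (Complex.exp (Complex.I * (ω i * x : ℝ)) * c i).im := by
  have h1 : ∀ T : ℝ, (1 / T) * ∫ x in (0 : ℝ)..T,
      ∑' i, (Complex.exp (Complex.I * (ω i * x : ℝ)) * c i).im =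
      ∑' i, (1 / T) * ∫ x in (0 : ℝ)..T, (Complex.exp (Complex.I * (ω i * x : ℝ)) * c i).im := by
    intro T
    rw [tsum_mul_left]
    congr 1
    refine (intervalIntegral.hasSum_integral_of_dominated_convergence (fun i _ => ‖c i‖)
      (fun i => ?_) (fun i => ae_of_all _ fun x _ => abs_im_exp_mul_le _ _)
      (ae_of_all _ fun _ _ => hc) ?_ (ae_of_all _ fun x _ => ?_)).tsum_eq.symm
    · exact Continuous.aestronglyMeasurable (by fun_prop)
    · exact intervalIntegrable_const
    · exact (summable_im_exp_mul hc x).hasSum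
  unfold MeanValueZero
  simp only [h1]
  have hnhds : 𝓝 (0 : ℝ) = 𝓝 (∑' _ : ι, (0 : ℝ)) := by rw [tsum_zero]
  rw [hnhds]
  refine tendsto_tsum_of_dominated_convergence hc (fun i => ?_) ?_
  · have h2 : Tendsto (fun T : ℝ => T⁻¹ * (2 * ‖c i‖ / |ω i|)) atTop (𝓝 0) := by
      simpa using tendsto_inv_atTop_zero.mul_const (2 * ‖c i‖ / |ω i|)
    refine squeeze_zero_norm' ?_ h2
    filter_upwards [eventually_gt_atTop 0] with T hT
    rw [norm_mul, Real.norm_eq_abs, Real.norm_eq_abs, one_div, abs_of_pos (inv_pos.2 hT)]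
    gcongr
    exact abs_integral_im_exp_mul_le (hω i) (c i) T
  · filter_upwards [eventually_gt_atTop 0] with T hT i
    have h3 := intervalIntegral.norm_integral_le_of_norm_le_const (a := 0) (b := T)
      (f := fun x : ℝ => (Complex.exp (Complex.I * (ω i * x : ℝ)) * c i).im) (C := ‖c i‖)
      fun x _ => abs_im_exp_mul_le _ _
    rw [sub_zero, abs_of_pos hT] at h3
    rw [norm_mul, Real.norm_eq_abs, one_div, abs_of_pos (inv_pos.2 hT), inv_mul_le_iff₀ hT,
      mul_comm T]
    exact h3

end AlmostPeriodic

/-! ### The asymptotic expansion of the averaged error -/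

section Expansion

open MeasureTheory Set Filter

variable {a : Fin 2 → ℝ} (v : OrthonormalBasis (Fin 2) ℝ Plane)

/-- The almost periodic coefficient that the `k`-th term of the expansion of `besselInt`, with
coefficient `α`, contributes to the averaged error. -/
def coeffSeries (a : Fin 2 → ℝ) (v : OrthonormalBasis (Fin 2) ℝ Plane) (α : ℂ) (k : ℕ)
    (x : ℝ) : ℝ :=
  ∑' n : {n : Fin 2 → ℤ // n ≠ 0},
    (Complex.exp (Complex.I * (Real.sqrt (Q a v (intVec n)) * x : ℝ)) * (((a 0 * a 1 / (3 * Real.pi ^ 2) * 2 * Q a v (intVec n) ^ (-(5 / 4 + k / 2 : ℝ)) : ℝ) : ℂ) *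
      α)).im

lemma summable_coeffSeries (ha : ∀ i, 0 < a i) (α : ℂ) (k : ℕ) :
    Summable fun n : {n : Fin 2 → ℤ // n ≠ 0} =>
      ‖((a 0 * a 1 / (3 * Real.pi ^ 2) * 2 * Q a v (intVec n) ^ (-(5 / 4 + k / 2 : ℝ)) : ℝ) : ℂ) *
        α‖ := by
  have hs : (1 : ℝ) < 5 / 4 + k / 2 := by
    have : (0 : ℝ) ≤ k := k.cast_nonneg
    linarith
  have h0 := ha 0
  have h1 := ha 1
  refine (((summable_Q_rpow v ha hs).mul_left (a 0 * a 1 / (3 * Real.pi ^ 2) * 2)).mul_right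
    ‖α‖).congr fun n => ?_
  rw [norm_mul, Complex.norm_real, Real.norm_of_nonneg]
  have := Real.rpow_nonneg (Q_nonneg v a (intVec n)) (-(5 / 4 + k / 2 : ℝ))
  positivity

lemma uniformlyAlmostPeriodic_coeffSeries (ha : ∀ i, 0 < a i) (α : ℂ) (k : ℕ) :
    UniformlyAlmostPeriodic (coeffSeries a v α k) :=
  uniformlyAlmostPeriodic_tsum (summable_coeffSeries v ha α k)

lemma meanValueZero_coeffSeries (ha : ∀ i, 0 < a i) (α : ℂ) (k : ℕ) :
    MeanValueZero (coeffSeries a v α k) :=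
  meanValueZero_tsum (fun n => (Real.sqrt_pos.2 (Q_intVec_pos v ha n)).ne')
    (summable_coeffSeries v ha α k)

lemma summable_leadingTerm (ha : ∀ i, 0 < a i) (x : ℝ) :
    Summable fun n : {n : Fin 2 → ℤ // n ≠ 0} => leadingTerm a v x n := by
  refine Summable.of_norm_bounded (summable_Q_rpow v ha (s := 5 / 4) (by norm_num)) fun n => ?_
  have := Real.rpow_nonneg (Q_nonneg v a (intVec n)) (-(5 / 4) : ℝ)
  rw [leadingTerm, norm_mul, Real.norm_of_nonneg this]
  exact mul_le_of_le_one_right this (Real.abs_cos_le_one _)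

lemma coeffSeries_zero_eq_leading :
    coeffSeries a v (sideFactor 0 * (Real.Gamma (5 / 2) : ℝ)) 0 = leading a v := by
  ext x
  rw [leading, ← tsum_mul_left, coeffSeries]
  refine tsum_congr fun n => ?_
  have h := two_mul_im_exp_mul_sideFactor (Real.sqrt (Q a v (intVec n)) * x)
  have hpi : Real.pi ^ (3 / 2 : ℝ) = Real.pi * Real.sqrt Real.pi := by
    rw [show (3 / 2 : ℝ) = 1 + 1 / 2 by norm_num, Real.rpow_add Real.pi_pos, Real.rpow_one,
      Real.sqrt_eq_rpow]
  have hs : Real.sqrt Real.pi ^ 2 = Real.pi := Real.sq_sqrt Real.pi_pos.le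
  have hs0 : 0 < Real.sqrt Real.pi := Real.sqrt_pos.2 Real.pi_pos
  rw [mul_left_comm, Complex.im_ofReal_mul, leadingTerm, ← Real.sqrt_eq_rpow, hpi]
  have e : ((5 : ℝ) / 4 + ((0 : ℕ) : ℝ) / 2) = 5 / 4 := by norm_num
  rw [e]
  set q := Q a v (intVec n) ^ (-(5 / 4) : ℝ)
  set m := (Complex.exp (Complex.I * ((Real.sqrt (Q a v (intVec n)) * x : ℝ) : ℂ)) *
    (sideFactor 0 * (Real.Gamma (5 / 2) : ℝ))).im
  set C := Real.cos (Real.sqrt (Q a v (intVec n)) * x - Real.pi / 4)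
  have hm : m = -(3 * Real.sqrt 2 * Real.sqrt Real.pi) * C / 2 := by linarith
  rw [hm]
  have hpp := Real.pi_pos.ne'
  field_simp
  linear_combination (-(a 0 * a 1 * q * C)) * hs

/-- The expansion of `besselInt` at `√(Q(n) R)`, summed over the nonzero integer points `n`; the
errors are summable in `n` because the exponents of `Q(n)` exceed `1`. -/
lemma exists_expansion_averagedError (ha : ∀ i, 0 < a i) : ∃ α : ℕ → ℂ,
    α 0 = sideFactor 0 * (Real.Gamma (5 / 2) : ℝ) ∧ ∀ N : ℕ, ∃ C : ℝ, ∀ R : ℝ, 1 ≤ R →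
      |averagedError a v R - ∑ k ∈ Finset.range N,
        coeffSeries a v (α k) k (Real.sqrt R) * R ^ (-(1 / 4 + k / 2 : ℝ))| ≤
        C * R ^ (-(1 / 4 + N / 2 : ℝ)) := by
  obtain ⟨α, h0, hα⟩ := exists_expansion_besselInt
  refine ⟨α, h0, fun N => ?_⟩
  obtain ⟨C, hC0, hC⟩ := hα N
  have ha0 := ha 0
  have ha1 := ha 1
  have hN : (0 : ℝ) ≤ N := N.cast_nonneg
  set A := a 0 * a 1 / (3 * Real.pi ^ 2) with hA
  have hA0 : 0 < A := by positivity
  have hs1 := summable_Q_rpow v ha (s := 5 / 4 + N / 2) (by linarith)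
  have hs2 := summable_Q_rpow v ha (s := 9 / 4 + N / 2) (by linarith)
  have hbd := ((hs1.add hs2).mul_left C)
  refine ⟨A * ∑' n : {n : Fin 2 → ℤ // n ≠ 0}, C * (Q a v (intVec n) ^ (-(5 / 4 + N / 2 : ℝ)) +
    Q a v (intVec n) ^ (-(9 / 4 + N / 2 : ℝ))), fun R hR => ?_⟩
  have hR0 : 0 < R := by linarith
  -- the `k`-th coefficient function, in terms of the expansion of `besselInt`
  have hterm : ∀ (k : ℕ) (n : {n : Fin 2 → ℤ // n ≠ 0}),
      A * R * (2 * (Complex.exp (Complex.I *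
        ((Real.sqrt (Q a v (intVec n)) * Real.sqrt R : ℝ) : ℂ)) * α k).im *
        (Real.sqrt (Q a v (intVec n)) * Real.sqrt R) ^ (-(5 / 2 + k : ℝ))) =
      (Complex.exp (Complex.I * (Real.sqrt (Q a v (intVec n)) * Real.sqrt R : ℝ)) *
        (((A * 2 * Q a v (intVec n) ^ (-(5 / 4 + k / 2 : ℝ)) : ℝ) : ℂ) * α k)).im *
        R ^ (-(1 / 4 + k / 2 : ℝ)) := by
    intro k n
    rw [mul_left_comm (Complex.exp _), Complex.im_ofReal_mul,
      sqrt_mul_sqrt_rpow (Q_nonneg v a _) hR0.le]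
    have e1 : (-(5 / 2 + k : ℝ)) / 2 = -(5 / 4 + k / 2 : ℝ) := by ring
    have e2 : R ^ (-(1 / 4 + k / 2 : ℝ)) = R * R ^ (-(5 / 4 + k / 2 : ℝ)) := by
      rw [← Real.rpow_one_add' hR0.le]
      · ring_nf
      · have : (0 : ℝ) ≤ k := k.cast_nonneg
        intro h
        linarith
    rw [e1, e2]
    ring
  have hsumk : ∀ k : ℕ, Summable fun n : {n : Fin 2 → ℤ // n ≠ 0} =>
      A * R * (2 * (Complex.exp (Complex.I *
        ((Real.sqrt (Q a v (intVec n)) * Real.sqrt R : ℝ) : ℂ)) * α k).im *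
        (Real.sqrt (Q a v (intVec n)) * Real.sqrt R) ^ (-(5 / 2 + k : ℝ))) := by
    intro k
    simp only [hterm]
    exact (summable_im_exp_mul (summable_coeffSeries v ha (α k) k) _).mul_right _
  have hcoeff : ∀ k : ℕ, coeffSeries a v (α k) k (Real.sqrt R) * R ^ (-(1 / 4 + k / 2 : ℝ)) =
      ∑' n : {n : Fin 2 → ℤ // n ≠ 0}, A * R * (2 * (Complex.exp (Complex.I *
        ((Real.sqrt (Q a v (intVec n)) * Real.sqrt R : ℝ) : ℂ)) * α k).im *
        (Real.sqrt (Q a v (intVec n)) * Real.sqrt R) ^ (-(5 / 2 + k : ℝ))) := by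
    intro k
    simp only [hterm]
    rw [tsum_mul_right]
    rfl
  have hb := (summable_besselInt v ha hR0).mul_left (A * R)
  rw [averagedError_eq v ha hR0, ← hA, ← tsum_mul_left, Finset.sum_congr rfl fun k _ => hcoeff k,
    ← Summable.tsum_finsetSum fun k _ => hsumk k,
    ← hb.tsum_sub (summable_sum fun k _ => hsumk k), mul_assoc, ← tsum_mul_right, ← tsum_mul_left]
  rw [← Real.norm_eq_abs]
  refine tsum_of_norm_bounded ((hbd.mul_right _).mul_left A).hasSum fun n => ?_
  have hQ := Q_intVec_pos v ha n
  have h := hC (Real.sqrt (Q a v (intVec n)) * Real.sqrt R) (by positivity)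
  rw [← Finset.mul_sum, ← mul_sub, norm_mul, Real.norm_eq_abs, Real.norm_eq_abs,
    abs_of_pos (by positivity), mul_assoc]
  refine mul_le_mul_of_nonneg_left ?_ hA0.le
  refine (mul_le_mul_of_nonneg_left h hR0.le).trans ?_
  rw [sqrt_mul_sqrt_rpow hQ.le hR0.le, sqrt_mul_sqrt_rpow hQ.le hR0.le]
  have e1 : (-(5 / 2 + N : ℝ)) / 2 = -(5 / 4 + N / 2 : ℝ) := by ring
  have e2 : (-(9 / 2 + N : ℝ)) / 2 = -(9 / 4 + N / 2 : ℝ) := by ring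
  have e3 : R ^ (-(1 / 4 + N / 2 : ℝ)) = R * R ^ (-(5 / 4 + N / 2 : ℝ)) := by
    rw [← Real.rpow_one_add' hR0.le]
    · ring_nf
    · intro h
      linarith
  -- The second error term of `besselInt` is dominated by the first because `R ≥ 1`.
  have e4 : R ^ (-(9 / 4 + N / 2 : ℝ)) ≤ R ^ (-(5 / 4 + N / 2 : ℝ)) :=
    Real.rpow_le_rpow_of_exponent_le hR (by linarith)
  rw [e1, e2, e3]
  calc _ ≤ R * (C * (Q a v (intVec n) ^ (-(5 / 4 + N / 2 : ℝ)) * R ^ (-(5 / 4 + N / 2 : ℝ)) +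
        Q a v (intVec n) ^ (-(9 / 4 + N / 2 : ℝ)) * R ^ (-(5 / 4 + N / 2 : ℝ)))) := by gcongr
    _ = _ := by ring

/-- Reindexing of the termwise expansion by `j = k + 1`, in the language of `IsBigO`. -/
lemma averagedError_asymptotics {a : Fin 2 → ℝ} (v : OrthonormalBasis (Fin 2) ℝ Plane)
    (ha : ∀ i, 0 < a i) :
    (∀ x : ℝ, Summable
      (fun n : {n : Fin 2 → ℤ // n ≠ 0} => leadingTerm a v x n)) ∧
    UniformlyAlmostPeriodic (leading a v) ∧
    MeanValueZero (leading a v) ∧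
    ((fun R : ℝ => averagedError a v R -
        leading a v (R ^ (1 / 2 : ℝ)) * R ^ (-(1 / 4) : ℝ))
      =O[Filter.atTop] fun R : ℝ => R ^ (-(3 / 4) : ℝ)) ∧
    ∃ g : ℕ → ℝ → ℝ,
      (∀ j, 1 ≤ j → UniformlyAlmostPeriodic (g j)) ∧
      g 1 = leading a v ∧
      ∀ n : ℕ, 1 ≤ n →
        (fun R : ℝ => averagedError a v R -
            ∑ j ∈ Finset.Icc 1 n, g j (R ^ (1 / 2 : ℝ)) * R ^ (1 / 4 - (j : ℝ) / 2))
          =O[Filter.atTop] fun R : ℝ => R ^ (-(1 / 4) - (n : ℝ) / 2) := by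
  obtain ⟨α, h0, hα⟩ := exists_expansion_averagedError v ha
  have hg1 : coeffSeries a v (α 0) 0 = leading a v := by
    rw [h0, coeffSeries_zero_eq_leading]
  have hexp : ∀ N : ℕ, (fun R : ℝ => averagedError a v R - ∑ j ∈ Finset.Icc 1 N,
      coeffSeries a v (α (j - 1)) (j - 1) (R ^ (1 / 2 : ℝ)) * R ^ (1 / 4 - (j : ℝ) / 2))
        =O[Filter.atTop] fun R : ℝ => R ^ (-(1 / 4) - (N : ℝ) / 2) := by
    intro N
    obtain ⟨C, hC⟩ := hα N
    refine Asymptotics.IsBigO.of_bound C ?_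
    filter_upwards [Filter.eventually_ge_atTop 1] with R hR
    rw [Real.norm_eq_abs, Real.norm_of_nonneg (Real.rpow_nonneg (by linarith) _)]
    have hsum : ∑ j ∈ Finset.Icc 1 N, coeffSeries a v (α (j - 1)) (j - 1) (R ^ (1 / 2 : ℝ)) *
        R ^ (1 / 4 - (j : ℝ) / 2) = ∑ k ∈ Finset.range N,
          coeffSeries a v (α k) k (Real.sqrt R) * R ^ (-(1 / 4 + k / 2 : ℝ)) := by
      rw [← Finset.Ico_add_one_right_eq_Icc, Finset.sum_Ico_eq_sum_range, Nat.add_sub_cancel,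
        ← Real.sqrt_eq_rpow]
      refine Finset.sum_congr rfl fun k _ => ?_
      rw [Nat.add_sub_cancel_left]
      congr 2
      push_cast
      ring
    rw [hsum, show -(1 / 4) - (N : ℝ) / 2 = -(1 / 4 + N / 2) by ring]
    exact hC R hR
  refine ⟨summable_leadingTerm v ha, ?_, ?_, ?_,
    fun j => coeffSeries a v (α (j - 1)) (j - 1),
    fun j _ => uniformlyAlmostPeriodic_coeffSeries v ha _ _, hg1, fun n _ => hexp n⟩
  · rw [← hg1]
    exact uniformlyAlmostPeriodic_coeffSeries v ha _ _
  · rw [← hg1]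
    exact meanValueZero_coeffSeries v ha _ _
  · have h := hexp 1
    simp only [Finset.Icc_self, Finset.sum_singleton, Nat.sub_self, hg1, Nat.cast_one] at h
    norm_num at h ⊢
    exact h

end Expansion

/-! ### Bases of the dual lattice and diagonalization of the Gram matrix -/

section Dual

/-- The dual lattice is the dual submodule with respect to the Euclidean inner product, and the
dual basis of a lattice basis spans it. -/
lemma exists_basis_dualLattice (L : Submodule ℤ Plane) [DiscreteTopology L] [IsZLattice ℝ L] :
    ∃ (d : Module.Basis (Fin 2) ℝ Plane) (b : Module.Basis (Fin 2) ℤ (dualLattice L)),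
      ∀ i, (b i : Plane) = d i := by
  have hfree : Module.Free ℤ L := ZLattice.module_free ℝ L
  have hfin : Module.Finite ℤ L := ZLattice.module_finite ℝ L
  have hrank : Module.finrank ℤ L = 2 := by
    rw [ZLattice.rank ℝ L]
    simp
  set e := (Module.finBasisOfFinrankEq ℤ L hrank).ofZLatticeBasis ℝ L with he
  have hspan : Submodule.span ℤ (Set.range e) = L :=
    (Module.finBasisOfFinrankEq ℤ L hrank).ofZLatticeBasis_span ℝ L
  have hB : LinearMap.BilinForm.Nondegenerate (innerₗ Plane : LinearMap.BilinForm ℝ Plane) := by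
    constructor
    · intro x hx
      exact inner_self_eq_zero.1 (hx x)
    · intro x hx
      exact inner_self_eq_zero.1 (hx x)
  have hdual : Submodule.span ℤ (Set.range (LinearMap.BilinForm.dualBasis _ hB e)) =
      dualLattice L := by
    rw [← LinearMap.BilinForm.dualSubmodule_span_of_basis, hspan]
    ext ξ
    rw [LinearMap.BilinForm.mem_dualSubmodule]
    refine forall₂_congr fun x _ => ?_
    rw [Submodule.mem_one]
    simp [eq_comm]
  refine ⟨LinearMap.BilinForm.dualBasis _ hB e,
    ((LinearMap.BilinForm.dualBasis _ hB e).restrictScalars ℤ).map (LinearEquiv.ofEq _ _ hdual),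
    fun i => ?_⟩
  simp

/-- The axes `v i` are eigenvectors of the Gram matrix of `d`, and `a i` is the inverse square root
of the eigenvalue. -/
lemma exists_diagonalization (d : Module.Basis (Fin 2) ℝ Plane) :
    ∃ (a : Fin 2 → ℝ) (v : OrthonormalBasis (Fin 2) ℝ Plane), (∀ i, 0 < a i) ∧
      ∀ n : Fin 2 → ℤ, inner ℝ (∑ i, n i • d i) (∑ i, n i • d i) = invForm a v (intVec n) := by
  have hG : (Matrix.gram ℝ d).PosDef := Matrix.posDef_gram_of_linearIndependent d.linearIndependent
  set v := hG.isHermitian.eigenvectorBasis with hv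
  set l := hG.isHermitian.eigenvalues with hl
  have hl0 : ∀ i, 0 < l i := hG.eigenvalues_pos
  refine ⟨fun i => (Real.sqrt (l i))⁻¹, v, fun i => inv_pos.2 (Real.sqrt_pos.2 (hl0 i)),
    fun n => ?_⟩
  set x : Fin 2 → ℝ := fun i => n i with hx
  have h1 : inner ℝ (∑ i, n i • d i) (∑ i, n i • d i) =
      x ⬝ᵥ (Matrix.gram ℝ d).mulVec x := by
    simp only [sum_inner, inner_sum, ← Int.cast_smul_eq_zsmul ℝ, real_inner_smul_left,
      real_inner_smul_right, dotProduct, Matrix.mulVec, Matrix.gram_apply, Finset.mul_sum, hx]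
    refine Finset.sum_congr rfl fun i _ => Finset.sum_congr rfl fun j _ => ?_
    rw [real_inner_comm (d i) (d j)]
    ring
  have h2 : ∀ i, inner ℝ (v i) (WithLp.toLp 2 ((Matrix.gram ℝ d).mulVec x)) =
      l i * inner ℝ (intVec n) (v i) := by
    intro i
    have h4 := hG.isHermitian.mulVec_eigenvectorBasis i
    rw [← hv, ← hl] at h4
    have hT : (Matrix.gram ℝ d).transpose = Matrix.gram ℝ d := by
      ext j k
      exact real_inner_comm (d j) (d k)
    have h5 : x ⬝ᵥ (Matrix.gram ℝ d).mulVec (v i) = (Matrix.gram ℝ d).mulVec x ⬝ᵥ v i := by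
      rw [Matrix.dotProduct_mulVec, ← Matrix.mulVec_transpose, hT]
    have h6 : inner ℝ (v i) (WithLp.toLp 2 ((Matrix.gram ℝ d).mulVec x)) =
        (Matrix.gram ℝ d).mulVec x ⬝ᵥ v i := by
      simp [PiLp.inner_apply, dotProduct]
    have h7 : inner ℝ (intVec n) (v i) = x ⬝ᵥ v i := by
      simp [PiLp.inner_apply, dotProduct, intVec, hx, mul_comm]
    rw [h6, ← h5, h4, h7, dotProduct_smul, smul_eq_mul]
  have h3 : x ⬝ᵥ (Matrix.gram ℝ d).mulVec x =
      inner ℝ (intVec n) (WithLp.toLp 2 ((Matrix.gram ℝ d).mulVec x)) := by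
    simp [PiLp.inner_apply, dotProduct, intVec, hx, mul_comm]
  rw [h1, h3, ← v.sum_inner_mul_inner, Fin.sum_univ_two, h2, h2, invForm]
  simp only [div_inv_eq_mul, mul_pow, Real.sq_sqrt (hl0 _).le]
  ring

/-- The counting function of a flat torus is the number of integer points in an ellipse: in a basis
of the dual lattice the norm squared is a positive definite form in the integer coordinates, which
the spectral theorem diagonalizes. -/
lemma exists_torusCount_eq_count (L : Submodule ℤ Plane) [DiscreteTopology L] [IsZLattice ℝ L] :
    ∃ (a : Fin 2 → ℝ) (v : OrthonormalBasis (Fin 2) ℝ Plane),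
      (∀ i, 0 < a i) ∧
      (∃ b : Module.Basis (Fin 2) ℤ (dualLattice L), ∀ n : Fin 2 → ℤ,
        inner ℝ (∑ i, n i • (b i : Plane)) (∑ i, n i • (b i : Plane)) =
          invForm a v (intVec n)) ∧
      ∀ t : ℝ, torusCount L t = count a v t := by
  obtain ⟨d, b, hb⟩ := exists_basis_dualLattice L
  obtain ⟨a, v, ha, hform⟩ := exists_diagonalization d
  refine ⟨a, v, ha, ⟨b, fun n => by simpa only [hb] using hform n⟩, fun t => ?_⟩
  set φ : (Fin 2 → ℤ) → Plane := fun n => ∑ i, n i • d i with hφ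
  have hφb : ∀ n, φ n = ((b.equivFun.symm n : dualLattice L) : Plane) := by
    intro n
    simp [hφ, Module.Basis.equivFun_symm_apply, hb]
  have hinj : Function.Injective φ := by
    intro m n h
    rw [hφb, hφb] at h
    exact b.equivFun.symm.injective (Subtype.ext h)
  have hset : {ξ : Plane | ξ ∈ dualLattice L ∧ (2 * Real.pi) ^ 2 * inner ℝ ξ ξ ≤ t} =
      φ '' {n | intVec n ∈ ellipse a v t} := by
    ext ξ
    constructor
    · rintro ⟨h1, h2⟩
      have h3 : φ (b.equivFun ⟨ξ, h1⟩) = ξ := by rw [hφb, LinearEquiv.symm_apply_apply]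
      refine ⟨b.equivFun ⟨ξ, h1⟩, ?_, h3⟩
      change (2 * Real.pi) ^ 2 * invForm a v (intVec _) ≤ t
      rw [← hform]
      change (2 * Real.pi) ^ 2 * inner ℝ (φ _) (φ _) ≤ t
      rwa [h3]
    · rintro ⟨n, h1, rfl⟩
      refine ⟨by rw [hφb]; exact Subtype.property _, ?_⟩
      have h2 : (2 * Real.pi) ^ 2 * invForm a v (intVec n) ≤ t := h1
      rwa [← hform] at h2
  rw [torusCount, hset, Set.ncard_image_of_injective _ hinj, count]

end Dual

end FlatTorus

end

theorem theorem4 :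
    -- for every lattice, the form `ξ · ξ` on the dual lattice can be diagonalized, and the
    -- eigenvalue counting function of the torus counts the points of `ℤ²` in ellipses
    (∀ (L : Submodule ℤ FlatTorus.Plane) [DiscreteTopology L] [IsZLattice ℝ L],
      ∃ (a : Fin 2 → ℝ) (v : OrthonormalBasis (Fin 2) ℝ FlatTorus.Plane),
        (∀ i, 0 < a i) ∧
        (∃ b : Module.Basis (Fin 2) ℤ (FlatTorus.dualLattice L), ∀ n : Fin 2 → ℤ,
          inner ℝ (∑ i, n i • (b i : FlatTorus.Plane)) (∑ i, n i • (b i : FlatTorus.Plane)) =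
            FlatTorus.invForm a v (FlatTorus.intVec n)) ∧
        ∀ t : ℝ, FlatTorus.torusCount L t = FlatTorus.count a v t) ∧
    -- the asymptotic expansions, for all axes and all orthonormal bases
    (∀ (a : Fin 2 → ℝ) (v : OrthonormalBasis (Fin 2) ℝ FlatTorus.Plane), (∀ i, 0 < a i) →
      (∀ x : ℝ, Summable
        (fun n : {n : Fin 2 → ℤ // n ≠ 0} => FlatTorus.leadingTerm a v x n)) ∧
      FlatTorus.UniformlyAlmostPeriodic (FlatTorus.leading a v) ∧
      FlatTorus.MeanValueZero (FlatTorus.leading a v) ∧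
      ((fun R : ℝ => FlatTorus.averagedError a v R -
          FlatTorus.leading a v (R ^ (1 / 2 : ℝ)) * R ^ (-(1 / 4) : ℝ))
        =O[Filter.atTop] fun R : ℝ => R ^ (-(3 / 4) : ℝ)) ∧
      ∃ g : ℕ → ℝ → ℝ,
        (∀ j, 1 ≤ j → FlatTorus.UniformlyAlmostPeriodic (g j)) ∧
        g 1 = FlatTorus.leading a v ∧
        ∀ n : ℕ, 1 ≤ n →
          (fun R : ℝ => FlatTorus.averagedError a v R -
              ∑ j ∈ Finset.Icc 1 n, g j (R ^ (1 / 2 : ℝ)) * R ^ (1 / 4 - (j : ℝ) / 2))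
            =O[Filter.atTop] fun R : ℝ => R ^ (-(1 / 4) - (n : ℝ) / 2)) :=
  ⟨fun L _ _ => FlatTorus.exists_torusCount_eq_count L,
    fun _ v ha => FlatTorus.averagedError_asymptotics v ha⟩
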